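/- Let $p,q\in\mathbb C\setminus\{0\}$ with $|p|<1$. For $x\neq 0$ put $\theta(x;p)=\prod_{j\ge 0}(1-p^jx)(1-p^{j+1}/x)$, and for integers $n\ge 0$ put $(a;q,p)_n=\prod_{k=0}^{n-1}\theta(aq^k;p)$ and $(a_1,\dots,a_r;q,p)_n=\prod_{j=1}^r(a_j;q,p)_n$. Let $m\ge 0$, $\mathbf n=(n_1,\dots,n_m)$ with integers $n_i\ge 0$, and $\mathbf c=(c_1,\dots,c_m)$ with $c_i\in\mathbb C\setminus\{0\}$. Let $W_{\mathbf c}^{\mathbf n}$ be the complex linear span of the meromorphic functions $$\frac{g(z_1,\dots,z_m)}{\prod_{i=1}^m(c_iz_i,c_i/z_i;q,p)_{k_i}},\qquad 0\le k_i\le n_i\quad(1\le i\le m),$$ where $g$ runs over all functions that are holomorphic in $z_1,\dots,z_m\ne0$, are invariant under $z_i\mapsto 1/z_i$ for each $i$, and satisfy, for each $i$, $$g(z_1,\dots,pz_i,\dots,z_m)=\frac{1}{p^{k_i}z_i^{2k_i}}\,g(z_1,\dots,z_m).$$ Theorem. Let $f\in W_{\mathbf c}^{\mathbf n}$ and let $a_i,z_i\in\mathbb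 C\setminus\{0\}$ $(1\le i\le m)$ be such that no denominator below vanishes, and such that $f$ is regular at $(z_1,\dots,z_m)$ and at all the points $(a_1q^{k_1},\dots,a_mq^{k_m})$ with $0\le k_i\le n_i$. Then $$\prod_{i=1}^m\frac{(a_i^2q,\,q,\,c_iz_i,\,c_i/z_i;q,p)_{n_i}}{(a_ic_i,\,c_i/a_i,\,a_iqz_i,\,a_iq/z_i;q,p)_{n_i}}\;f(z_1,\dots,z_m)$$ $$=\sum_{k_1=0}^{n_1}\cdots\sum_{k_m=0}^{n_m}\left(\prod_{i=1}^m q^{k_i}\,\frac{\theta(a_i^2q^{2k_i};p)}{\theta(a_i^2;p)}\,\frac{(q^{-n_i},\,a_i^2,\,a_iq/c_i,\,a_ic_iq^{n_i},\,a_iz_i,\,a_i/z_i;q,p)_{k_i}}{(q,\,a_i^2q^{n_i+1},\,a_ic_i,\,a_iq^{1-n_i}/c_i,\,a_iqz_i,\,a_iq/z_i;q,p)_{k_i}}\right)f(a_1q^{k_1},\dots,a_mq^{k_m}).$$ -/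

import Mathlib

noncomputable section

namespace EllipticInterpolation

/-- The modified Jacobi theta function
`θ(x;p) = ∏_{j ≥ 0} (1 - p^j x) (1 - p^{j+1}/x)`, for `x ≠ 0` and `|p| < 1`. -/
def theta (p x : ℂ) : ℂ :=
  ∏' j : ℕ, ((1 - p ^ j * x) * (1 - p ^ (j + 1) / x))

/-- The theta shifted factorial `(a;q,p)_n = ∏_{k=0}^{n-1} θ(a q^k;p)`, for `n ≥ 0`. -/
def thetaFac (q p a : ℂ) (n : ℕ) : ℂ :=
  ∏ k ∈ Finset.range n, theta p (a * q ^ k)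

/-- The multiple theta shifted factorial
`(a_1,…,a_r;q,p)_n = (a_1;q,p)_n ⋯ (a_r;q,p)_n`. -/
def thetaFacs (q p : ℂ) (as : List ℂ) (n : ℕ) : ℂ :=
  (as.map fun a => thetaFac q p a n).prod

/-- `g` is holomorphic in `z_1,…,z_m ≠ 0`, symmetric in `z_i` and `1/z_i` for every `i`, and
`g(z_1,…,p z_i,…,z_m) = p^{-k_i} z_i^{-2 k_i} g(z_1,…,z_m)` for every `i`. -/
structure IsThetaFunction {m : ℕ} (p : ℂ) (k : Fin m → ℕ) (g : (Fin m → ℂ) → ℂ) : Prop where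
  holomorphic : DifferentiableOn ℂ g {z | ∀ i, z i ≠ 0}
  symm : ∀ z : Fin m → ℂ, (∀ i, z i ≠ 0) → ∀ i,
    g (Function.update z i (1 / z i)) = g z
  quasiPeriodic : ∀ z : Fin m → ℂ, (∀ i, z i ≠ 0) → ∀ i,
    g (Function.update z i (p * z i)) = 1 / (p ^ k i * z i ^ (2 * k i)) * g z

/-- The linear span of the quotients
`g_k(z_1,…,z_m) / ∏_i (c_i z_i, c_i/z_i;q,p)_{k_i}`, `0 ≤ k_i ≤ n_i`. -/
def spanW {m : ℕ} (q p : ℂ) (c : Fin m → ℂ) (n : Fin m → ℕ) :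
    Submodule ℂ ((Fin m → ℂ) → ℂ) :=
  Submodule.span ℂ
    {f | ∃ (k : Fin m → ℕ) (g : (Fin m → ℂ) → ℂ), (∀ i, k i ≤ n i) ∧ IsThetaFunction p k g ∧
      f = fun z => g z / ∏ i, thetaFacs q p [c i * z i, c i / z i] (k i)}

/-- The space `W_{c_1,…,c_m}^{n_1,…,n_m}`. Its elements are meromorphic functions on `(ℂ \ {0})^m`:
they are given by an element of the span where the denominators do not vanish, and the value that
Lean's division by zero would assign at the other points is of no relevance. -/
def W {m : ℕ} (q p : ℂ) (c : Fin m → ℂ) (n : Fin m → ℕ) : Set ((Fin m → ℂ) → ℂ) :=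
  {f | ∃ h ∈ spanW q p c n, ∀ z : Fin m → ℂ,
    (∀ i, z i ≠ 0 ∧ thetaFacs q p [c i * z i, c i / z i] (n i) ≠ 0) → f z = h z}

end EllipticInterpolation

end

/-!
Multiplying `f` by its common denominator `∏ᵢ (cᵢzᵢ, cᵢ/zᵢ;q,p)_{nᵢ}` turns it into a function that
is, in each variable `zᵢ`, a symmetric theta function of degree `nᵢ`. The formula is Lagrange
interpolation of this function at the grid of nodes `(a₁q^{k₁},…,a_mq^{k_m})`.

In one variable, the Laurent coefficients `c_j` of a symmetric theta function of degree `n` satisfy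
`c_{-j} = c_j` and `c_{j+2n} = p^{n+j} c_j`, so they are determined by `c_0,…,c_n`
(`IsSymmTheta.eq_zero_of_laurentCoeff`) and the space of these functions has dimension at most
`n + 1`. The products `lagrangeTheta` are dual to the evaluations at the `n + 1` nodes, hence form a
basis, and a function that vanishes at all nodes is zero (`IsSymmTheta.eq_zero_of_nodes`). Releasing
the variables from the grid one at a time gives the same uniqueness in several variables, and with
it the Lagrange expansion `IsThetaFunction.eq_sum_lagrangeTheta`.

The coefficients of the expansion are brought to the form of the theorem by
`θ(1/x;p) = -x⁻¹ θ(x;p)` and by splitting theta shifted factorials (`lagrangeTheta_coefficient`).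

This argument needs distinct nodes, and nonzero denominators of `f` at the nodes and at `z`. The
exceptional values of each `aᵢ` and each `zᵢ` form countable sets, so the remaining case follows by
continuity in `(a, z)` (`interpolation_formula`).
-/

noncomputable section

namespace EllipticInterpolation

/-! ### The theta function -/

/-- The infinite product `(x;p)_∞ = ∏_{j ≥ 0} (1 - p^j x)`, an entire function of `x`. -/
def pochInf (p x : ℂ) : ℂ :=
  ∏' j : ℕ, (1 - p ^ j * x)

lemma summable_norm_pow_mul {p : ℂ} (hp1 : ‖p‖ < 1) (x : ℂ) :
    Summable fun j : ℕ => ‖-(p ^ j * x)‖ := by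
  simpa using (summable_geometric_of_lt_one (norm_nonneg p) hp1).mul_right ‖x‖

lemma multipliable_pochInf {p : ℂ} (hp1 : ‖p‖ < 1) (x : ℂ) :
    Multipliable fun j : ℕ => 1 - p ^ j * x := by
  simpa [sub_eq_add_neg] using multipliable_one_add_of_summable (summable_norm_pow_mul hp1 x)

lemma pochInf_eq_one_sub_mul {p : ℂ} (hp1 : ‖p‖ < 1) (x : ℂ) :
    pochInf p x = (1 - x) * pochInf p (p * x) := by
  have hj : ∀ j : ℕ, 1 - p ^ (j + 1) * x = 1 - p ^ j * (p * x) := fun j => by ring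
  have h : Multipliable fun j : ℕ => 1 - p ^ (j + 1) * x := by
    simpa only [hj] using multipliable_pochInf hp1 (p * x)
  have h0 : ∏' j : ℕ, (1 - p ^ j * x) = (1 - p ^ 0 * x) * ∏' j : ℕ, (1 - p ^ (j + 1) * x) :=
    tprod_eq_zero_mul' (f := fun j : ℕ => 1 - p ^ j * x) h
  simp only [hj, pow_zero, one_mul] at h0
  exact h0

lemma exists_pow_mul_eq_one_of_pochInf_eq_zero {p : ℂ} (hp1 : ‖p‖ < 1) {x : ℂ}
    (hx : pochInf p x = 0) : ∃ j : ℕ, p ^ j * x = 1 := by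
  by_contra! h
  refine tprod_one_add_ne_zero_of_summable (f := fun j : ℕ => -(p ^ j * x)) (fun j => ?_)
    (summable_norm_pow_mul hp1 x) (by simpa [pochInf, sub_eq_add_neg] using hx)
  rw [← sub_eq_add_neg, sub_ne_zero]
  exact (h j).symm

lemma differentiable_pochInf {p : ℂ} (hp1 : ‖p‖ < 1) : Differentiable ℂ (pochInf p) := by
  intro x
  have hsum : Summable fun j : ℕ => ‖p‖ ^ j * (‖x‖ + 1) :=
    (summable_geometric_of_lt_one (norm_nonneg p) hp1).mul_right _
  have hprod := Summable.hasProdLocallyUniformlyOn_nat_one_add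
    (f := fun (j : ℕ) (y : ℂ) => -(p ^ j * y)) (K := Metric.ball (0 : ℂ) (‖x‖ + 1))
    Metric.isOpen_ball hsum (.of_forall fun j y hy => ?_) (fun j => by fun_prop)
  · have hdiff : DifferentiableOn ℂ (fun y => ∏' j : ℕ, (1 + -(p ^ j * y)))
        (Metric.ball (0 : ℂ) (‖x‖ + 1)) :=
      hprod.differentiableOn (.of_forall fun _ => by
        simpa [Finset.prod_fn] using DifferentiableOn.finsetProd (fun _ _ => by fun_prop))
        Metric.isOpen_ball
    have := hdiff.differentiableAt (Metric.isOpen_ball.mem_nhds (x := x) (by simp))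
    have heq : pochInf p = fun y => ∏' j : ℕ, (1 + -(p ^ j * y)) := by
      funext y
      simp only [pochInf, sub_eq_add_neg]
    rwa [heq]
  · have : ‖y‖ ≤ ‖x‖ + 1 := by simpa using (mem_ball_zero_iff.1 hy).le
    simpa using mul_le_mul_of_nonneg_left this (by positivity)

lemma theta_eq_pochInf_mul {p : ℂ} (hp1 : ‖p‖ < 1) (x : ℂ) :
    theta p x = pochInf p x * pochInf p (p / x) := by
  have h : ∀ j : ℕ, p ^ (j + 1) / x = p ^ j * (p / x) := fun j => by ring
  simp only [theta, pochInf, h]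
  exact (multipliable_pochInf hp1 x).tprod_mul (multipliable_pochInf hp1 (p / x))

lemma theta_mul_left {p : ℂ} (hp0 : p ≠ 0) (hp1 : ‖p‖ < 1) {x : ℂ} (hx : x ≠ 0) :
    theta p (p * x) = -(1 / x) * theta p x := by
  have h : p / (p * x) = 1 / x := by field_simp
  have h' : p * (1 / x) = p / x := by ring
  rw [theta_eq_pochInf_mul hp1, theta_eq_pochInf_mul hp1, h, pochInf_eq_one_sub_mul hp1 (1 / x),
    h', pochInf_eq_one_sub_mul hp1 x]
  field_simp
  ring

lemma theta_one_div {p : ℂ} (hp1 : ‖p‖ < 1) {x : ℂ} (hx : x ≠ 0) :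
    theta p (1 / x) = -(1 / x) * theta p x := by
  have h : p / (1 / x) = p * x := by field_simp
  have h' : p * (1 / x) = p / x := by ring
  rw [theta_eq_pochInf_mul hp1, theta_eq_pochInf_mul hp1, h, pochInf_eq_one_sub_mul hp1 (1 / x),
    h', pochInf_eq_one_sub_mul hp1 x]
  field_simp
  ring

lemma theta_one {p : ℂ} (hp1 : ‖p‖ < 1) : theta p 1 = 0 := by
  rw [theta_eq_pochInf_mul hp1, pochInf_eq_one_sub_mul hp1 1]
  simp

lemma theta_eq_neg_mul_theta_inv {p : ℂ} (hp1 : ‖p‖ < 1) {x : ℂ} (hx : x ≠ 0) :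
    theta p x = -x * theta p x⁻¹ := by
  rw [← one_div, theta_one_div hp1 hx]
  field_simp

lemma theta_div_left {p : ℂ} (hp0 : p ≠ 0) (hp1 : ‖p‖ < 1) {x : ℂ} (hx : x ≠ 0) :
    theta p (x / p) = -(x / p) * theta p x := by
  have hxp : x / p ≠ 0 := div_ne_zero hx hp0
  have h := theta_mul_left hp0 hp1 hxp
  rw [mul_div_cancel₀ x hp0] at h
  rw [h]
  field_simp

lemma exists_eq_zpow_of_theta_eq_zero {p : ℂ} (hp1 : ‖p‖ < 1) {x : ℂ} (hx : x ≠ 0)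
    (h : theta p x = 0) : ∃ j : ℤ, x = p ^ j := by
  rw [theta_eq_pochInf_mul hp1, mul_eq_zero] at h
  rcases h with h | h
  · obtain ⟨j, hj⟩ := exists_pow_mul_eq_one_of_pochInf_eq_zero hp1 h
    exact ⟨-j, by rw [zpow_neg, zpow_natCast, eq_inv_of_mul_eq_one_right hj]⟩
  · obtain ⟨j, hj⟩ := exists_pow_mul_eq_one_of_pochInf_eq_zero hp1 h
    refine ⟨(j + 1 : ℕ), ?_⟩
    rw [zpow_natCast, pow_succ]
    field_simp at hj
    linear_combination -hj

lemma differentiableAt_theta {p : ℂ} (hp1 : ‖p‖ < 1) {x : ℂ} (hx : x ≠ 0) :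
    DifferentiableAt ℂ (theta p) x := by
  rw [show theta p = fun x => pochInf p x * pochInf p (p / x) from
    funext (theta_eq_pochInf_mul hp1)]
  have h : DifferentiableAt ℂ (fun x => p / x) x :=
    (differentiableAt_const p).div differentiableAt_id hx
  exact (differentiable_pochInf hp1 x).mul
    (DifferentiableAt.comp x (differentiable_pochInf hp1 (p / x)) h)

lemma countable_theta_zeros {p : ℂ} (hp1 : ‖p‖ < 1) :
    {x : ℂ | x = 0 ∨ theta p x = 0}.Countable := by
  refine ((Set.countable_singleton (0 : ℂ)).union
    (Set.countable_range fun j : ℤ => p ^ j)).mono fun x hx => ?_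
  by_cases hx0 : x = 0
  · exact Or.inl hx0
  · obtain ⟨j, hj⟩ := exists_eq_zpow_of_theta_eq_zero hp1 hx0 (hx.resolve_left hx0)
    exact Or.inr ⟨j, hj.symm⟩

/-! ### Laurent coefficients of holomorphic functions on the punctured plane -/

/-- The `j`-th Laurent coefficient, up to the factor `2π`, of a function holomorphic in the
punctured plane, as an integral over the circle of radius `r` with centre `0`. -/
def laurentCoeff (F : ℂ → ℂ) (r : ℝ) (j : ℤ) : ℂ :=
  ∫ t in (0 : ℝ)..2 * Real.pi, circleMap 0 r t ^ (-j) * F (circleMap 0 r t)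

lemma circleIntegral_eq_laurentCoeff (F : ℂ → ℂ) {r : ℝ} (hr : r ≠ 0) (j : ℤ) :
    (∮ z in C(0, r), (z - 0)⁻¹ • (z ^ (-j) * F z)) = Complex.I * laurentCoeff F r j := by
  rw [circleIntegral, laurentCoeff, ← intervalIntegral.integral_const_mul]
  refine intervalIntegral.integral_congr fun t _ => ?_
  have h : circleMap 0 r t ≠ 0 := circleMap_ne_center hr
  simp only [deriv_circleMap, sub_zero, smul_eq_mul]
  field_simp

/-- The Laurent coefficients do not depend on the radius, by Cauchy's theorem for an annulus. -/
lemma laurentCoeff_eq_of_pos {F : ℂ → ℂ} (hF : DifferentiableOn ℂ F {z | z ≠ 0}) {r R : ℝ}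
    (hr : 0 < r) (hR : 0 < R) (j : ℤ) : laurentCoeff F r j = laurentCoeff F R j := by
  wlog hle : r ≤ R generalizing r R
  · exact (this hR hr (le_of_not_ge hle)).symm
  have hd : DifferentiableOn ℂ (fun z => z ^ (-j) * F z) {z | z ≠ 0} :=
    DifferentiableOn.mul (fun z hz =>
      (differentiableAt_zpow.2 (Or.inl hz)).differentiableWithinAt) hF
  have h := Complex.circleIntegral_sub_center_inv_smul_eq_of_differentiable_on_annulus_off_countable
    hr hle (f := fun z => z ^ (-j) * F z) (c := 0) Set.countable_empty
    (hd.continuousOn.mono fun z hz => ?_) (fun z hz => ?_)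
  · rw [circleIntegral_eq_laurentCoeff F hr.ne', circleIntegral_eq_laurentCoeff F hR.ne'] at h
    exact (mul_left_cancel₀ Complex.I_ne_zero h).symm
  · rintro rfl
    exact hz.2 (Metric.mem_ball_self hr)
  · refine hd.differentiableAt (isOpen_ne.mem_nhds ?_)
    rintro rfl
    exact hz.1.2 (Metric.mem_closedBall_self hr.le)

/-- The argument of `p` is absorbed by a rotation of the circle of integration. -/
lemma laurentCoeff_comp_mul_left (F : ℂ → ℂ) {p : ℂ} (hp : p ≠ 0) (r : ℝ) (j : ℤ) :
    laurentCoeff (fun z => F (p * z)) r j = p ^ j * laurentCoeff F (‖p‖ * r) j := by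
  set H : ℝ → ℂ := fun t => circleMap 0 (‖p‖ * r) t ^ (-j) * F (circleMap 0 (‖p‖ * r) t) with hH
  have hper : Function.Periodic H (2 * Real.pi) := fun t => by
    simp only [hH, periodic_circleMap 0 (‖p‖ * r) t]
  have hmul : ∀ t : ℝ, p * circleMap 0 r t = circleMap 0 (‖p‖ * r) (t + p.arg) := fun t => by
    conv_lhs => rw [← Complex.norm_mul_exp_arg_mul_I p]
    simp only [circleMap_zero]
    push_cast
    rw [add_mul, Complex.exp_add]
    ring
  have hint : ∀ t : ℝ, circleMap 0 r t ^ (-j) * F (p * circleMap 0 r t) =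
      p ^ j * H (t + p.arg) := fun t => by
    simp only [hH, ← hmul, mul_zpow]
    rw [← mul_assoc, ← mul_assoc, ← zpow_add₀ hp]
    simp
  have hshift : ∫ t in (0 : ℝ)..2 * Real.pi, H (t + p.arg) = ∫ t in (0 : ℝ)..2 * Real.pi, H t := by
    rw [intervalIntegral.integral_comp_add_right, zero_add, add_comm (2 * Real.pi)]
    simpa using hper.intervalIntegral_add_eq p.arg 0
  simp only [laurentCoeff, hint]
  rw [intervalIntegral.integral_const_mul, hshift]

lemma laurentCoeff_comp_one_div (F : ℂ → ℂ) (j : ℤ) :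
    laurentCoeff (fun z => F (1 / z)) 1 j = laurentCoeff F 1 (-j) := by
  set H : ℝ → ℂ := fun t => circleMap 0 1 t ^ j * F (circleMap 0 1 t) with hH
  have hper : Function.Periodic H (2 * Real.pi) := fun t => by
    simp only [hH, periodic_circleMap 0 1 t]
  have hinv : ∀ t : ℝ, circleMap 0 1 (-t) = (circleMap 0 1 t)⁻¹ := fun t => by
    simp [circleMap_zero, ← Complex.exp_neg]
  have hint : ∀ t : ℝ, circleMap 0 1 t ^ (-j) * F (1 / circleMap 0 1 t) = H (-t) := fun t => by
    simp only [hH, hinv, one_div, inv_zpow, zpow_neg]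
  simp only [laurentCoeff, hint, neg_neg]
  rw [intervalIntegral.integral_comp_neg (fun t => H t)]
  simpa using hper.intervalIntegral_add_eq (-(2 * Real.pi)) 0

/-- On the circle through `z`, the Laurent coefficients of `F` are its Fourier coefficients up to
nonzero factors, and a continuous function with vanishing Fourier coefficients is zero. -/
lemma eq_zero_of_laurentCoeff_eq_zero {F : ℂ → ℂ} (hF : DifferentiableOn ℂ F {z | z ≠ 0})
    (h : ∀ j, laurentCoeff F 1 j = 0) {z : ℂ} (hz : z ≠ 0) : F z = 0 := by
  have : Fact (0 < 2 * Real.pi) := ⟨Real.two_pi_pos⟩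
  have hr : 0 < ‖z‖ := norm_pos_iff.2 hz
  have hcont : Continuous fun θ : AddCircle (2 * Real.pi) =>
      F (‖z‖ * (AddCircle.toCircle θ : ℂ)) := by
    refine hF.continuousOn.comp_continuous ?_ fun θ => ?_
    · exact continuous_const.mul (continuous_subtype_val.comp AddCircle.continuous_toCircle)
    · exact mul_ne_zero (Complex.ofReal_ne_zero.2 hr.ne') (Circle.coe_ne_zero _)
  let f : C(AddCircle (2 * Real.pi), ℂ) := ⟨_, hcont⟩
  have hpi : (Real.pi : ℂ) ≠ 0 := Complex.ofReal_ne_zero.2 Real.pi_ne_zero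
  have hcirc : ∀ t : ℝ, (‖z‖ : ℂ) * (AddCircle.toCircle (t : AddCircle (2 * Real.pi)) : ℂ) =
      circleMap 0 ‖z‖ t := fun t => by
    rw [AddCircle.toCircle_apply_mk, circleMap_zero, Circle.coe_exp]
    congr 2
    push_cast
    field_simp
  have hcoeff : ∀ j, fourierCoeff f j = 0 := fun j => by
    rw [fourierCoeff_eq_intervalIntegral f j 0]
    have hint : ∀ t : ℝ, @fourier (2 * Real.pi) (-j) t • f t =
        (‖z‖ : ℂ) ^ j * (circleMap 0 ‖z‖ t ^ (-j) * F (circleMap 0 ‖z‖ t)) := fun t => by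
      have hf : f t = F (circleMap 0 ‖z‖ t) := by rw [← hcirc]; rfl
      rw [hf, ← hcirc, fourier_apply, AddCircle.toCircle_zsmul, Circle.coe_zpow, mul_zpow,
        smul_eq_mul, ← mul_assoc, ← mul_assoc, ← zpow_add₀ (Complex.ofReal_ne_zero.2 hr.ne')]
      simp
    simp only [hint, zero_add]
    rw [intervalIntegral.integral_const_mul]
    have := laurentCoeff_eq_of_pos hF hr one_pos j
    rw [h, laurentCoeff] at this
    rw [this]
    simp
  have hsum := has_pointwise_sum_fourier_series_of_summable (f := f)
    (by simp [funext hcoeff]) (z.arg : AddCircle (2 * Real.pi))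
  have hzero : f (z.arg : AddCircle (2 * Real.pi)) = 0 := by
    refine hsum.unique ?_
    simp [hcoeff]
  have hfz : f (z.arg : AddCircle (2 * Real.pi)) = F z := by
    change F _ = F z
    rw [hcirc, circleMap_zero, Complex.norm_mul_exp_arg_mul_I]
  rw [← hfz, hzero]

/-! ### Symmetric theta functions of one variable -/

/-- Symmetric theta functions of degree `n` in one variable: holomorphic for `z ≠ 0`, invariant
under `z ↦ 1 / z`, with multiplier `p^{-n} z^{-2n}` under `z ↦ p z`. The value at `0` is
unconstrained. -/
structure IsSymmTheta (p : ℂ) (n : ℕ) (F : ℂ → ℂ) : Prop where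
  holomorphic : DifferentiableOn ℂ F {z | z ≠ 0}
  symm : ∀ z, z ≠ 0 → F (1 / z) = F z
  quasiPeriodic : ∀ z, z ≠ 0 → F (p * z) = 1 / (p ^ n * z ^ (2 * n)) * F z

lemma laurentCoeff_congr {F G : ℂ → ℂ} (h : ∀ z, z ≠ 0 → F z = G z) {r : ℝ} (hr : r ≠ 0) (j : ℤ) :
    laurentCoeff F r j = laurentCoeff G r j := by
  refine intervalIntegral.integral_congr fun t _ => ?_
  simp only [h _ (circleMap_ne_center hr)]

namespace IsSymmTheta

variable {p : ℂ} {n : ℕ} {F G : ℂ → ℂ}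

lemma laurentCoeff_neg (hF : IsSymmTheta p n F) (j : ℤ) :
    laurentCoeff F 1 (-j) = laurentCoeff F 1 j := by
  rw [← laurentCoeff_comp_one_div]
  exact laurentCoeff_congr hF.symm one_ne_zero j

/-- The recursion for the Laurent coefficients that expresses quasi-periodicity. -/
lemma laurentCoeff_add (hF : IsSymmTheta p n F) (hp0 : p ≠ 0) (j : ℤ) :
    laurentCoeff F 1 (j + 2 * n) = p ^ (n + j) * laurentCoeff F 1 j := by
  have h1 := laurentCoeff_comp_mul_left F hp0 1 j
  rw [laurentCoeff_congr hF.quasiPeriodic one_ne_zero, mul_one,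
    laurentCoeff_eq_of_pos hF.holomorphic (norm_pos_iff.2 hp0) one_pos] at h1
  have h2 : laurentCoeff (fun z => 1 / (p ^ n * z ^ (2 * n)) * F z) 1 j =
      (p ^ n)⁻¹ * laurentCoeff F 1 (j + 2 * n) := by
    rw [laurentCoeff, laurentCoeff, ← intervalIntegral.integral_const_mul]
    refine intervalIntegral.integral_congr fun t _ => ?_
    have h : circleMap 0 1 t ≠ 0 := circleMap_ne_center one_ne_zero
    have h3 : circleMap 0 1 t ^ (-(j + 2 * (n : ℤ))) =
        circleMap 0 1 t ^ (-j) * (circleMap 0 1 t ^ (2 * n))⁻¹ := by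
      rw [neg_add, zpow_add₀ h, ← zpow_natCast, ← zpow_neg]
      push_cast
      rfl
    simp only [h3]
    field_simp
  rw [h2] at h1
  rw [zpow_add₀ hp0, zpow_natCast, mul_assoc, ← h1, mul_inv_cancel_left₀ (pow_ne_zero n hp0)]

/-- A symmetric theta function of degree `n` is determined by its Laurent coefficients of index
`0, …, n`, hence these functions form a space of dimension at most `n + 1`. -/
lemma eq_zero_of_laurentCoeff (hF : IsSymmTheta p n F) (hp0 : p ≠ 0) (hp1 : ‖p‖ < 1)
    (h : ∀ j : Fin (n + 1), laurentCoeff F 1 (j : ℕ) = 0) {z : ℂ} (hz : z ≠ 0) : F z = 0 := by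
  refine eq_zero_of_laurentCoeff_eq_zero hF.holomorphic (fun j => ?_) hz
  suffices H : ∀ j : ℕ, laurentCoeff F 1 j = 0 by
    rcases Int.eq_nat_or_neg j with ⟨k, rfl | rfl⟩
    · exact H k
    · rw [hF.laurentCoeff_neg, H]
  intro j
  induction j using Nat.strong_induction_on with
  | _ j ih =>
    by_cases hj : j ≤ n
    · exact h ⟨j, by omega⟩
    rcases Nat.eq_zero_or_pos n with rfl | hn
    · -- In degree `0` the recursion reads `c_j = p ^ j c_j`.
      have h1 := hF.laurentCoeff_add hp0 j
      simp only [CharP.cast_eq_zero, mul_zero, add_zero, zero_add, zpow_natCast] at h1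
      have h2 : p ^ j ≠ 1 := fun h2 => by
        have h3 := pow_lt_one₀ (norm_nonneg p) hp1 (show j ≠ 0 by omega)
        rw [← norm_pow, h2, norm_one] at h3
        exact lt_irrefl _ h3
      have h4 : (1 - p ^ j) * laurentCoeff F 1 j = 0 := by linear_combination h1
      exact (mul_eq_zero.1 h4).resolve_left (sub_ne_zero.2 h2.symm)
    · have h1 := hF.laurentCoeff_add hp0 ((j : ℤ) - 2 * n)
      rw [sub_add_cancel] at h1
      rw [h1]
      -- The index `j - 2 n` has smaller absolute value than `j` because `j > n > 0`.
      rcases le_total (2 * n) j with h2 | h2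
      · have h3 := ih (j - 2 * n) (by omega)
        push_cast [h2] at h3
        rw [h3, mul_zero]
      · have h3 := ih (2 * n - j) (by omega)
        push_cast [h2] at h3
        rw [← hF.laurentCoeff_neg, neg_sub, h3, mul_zero]

lemma zero : IsSymmTheta p n (fun _ => 0) :=
  ⟨differentiableOn_const _, by simp, by simp⟩

lemma add (hF : IsSymmTheta p n F) (hG : IsSymmTheta p n G) :
    IsSymmTheta p n (fun z => F z + G z) where
  holomorphic := hF.holomorphic.add hG.holomorphic
  symm z hz := by rw [hF.symm z hz, hG.symm z hz]
  quasiPeriodic z hz := by rw [hF.quasiPeriodic z hz, hG.quasiPeriodic z hz, mul_add]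

lemma const_mul (hF : IsSymmTheta p n F) (b : ℂ) : IsSymmTheta p n (fun z => b * F z) where
  holomorphic := hF.holomorphic.const_mul b
  symm z hz := by rw [hF.symm z hz]
  quasiPeriodic z hz := by rw [hF.quasiPeriodic z hz, mul_left_comm]

lemma one : IsSymmTheta p 0 (fun _ => 1) :=
  ⟨differentiableOn_const _, by simp, by simp⟩

lemma mul {k l : ℕ} (hF : IsSymmTheta p k F) (hG : IsSymmTheta p l G) :
    IsSymmTheta p (k + l) (fun z => F z * G z) where
  holomorphic := hF.holomorphic.mul hG.holomorphic
  symm z hz := by rw [hF.symm z hz, hG.symm z hz]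
  quasiPeriodic z hz := by
    rw [hF.quasiPeriodic z hz, hG.quasiPeriodic z hz, pow_add, mul_add, pow_add]
    simp only [one_div, mul_inv]
    ring

lemma sum {ι : Type*} (s : Finset ι) {φ : ι → ℂ → ℂ} (h : ∀ i ∈ s, IsSymmTheta p n (φ i)) :
    IsSymmTheta p n (fun z => ∑ i ∈ s, φ i z) := by
  classical
  induction s using Finset.induction_on with
  | empty => simpa using zero
  | insert i s hi ih =>
    simp only [Finset.sum_insert hi]
    exact (h i (Finset.mem_insert_self i s)).add
      (ih fun j hj => h j (Finset.mem_insert_of_mem hj))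

lemma prod {ι : Type*} (s : Finset ι) {φ : ι → ℂ → ℂ} (h : ∀ i ∈ s, IsSymmTheta p 1 (φ i)) :
    IsSymmTheta p s.card (fun z => ∏ i ∈ s, φ i z) := by
  classical
  induction s using Finset.induction_on with
  | empty => simpa using one
  | insert i s hi ih =>
    simp only [Finset.prod_insert hi, Finset.card_insert_of_notMem hi, add_comm s.card]
    exact (h i (Finset.mem_insert_self i s)).mul
      (ih fun j hj => h j (Finset.mem_insert_of_mem hj))

lemma theta_mul_theta_div (hp0 : p ≠ 0) (hp1 : ‖p‖ < 1) {b : ℂ} (hb : b ≠ 0) :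
    IsSymmTheta p 1 (fun z => theta p (b * z) * theta p (b / z)) where
  holomorphic z hz := by
    have h1 : DifferentiableAt ℂ (fun z => b * z) z := by fun_prop
    have h2 : DifferentiableAt ℂ (fun z => b / z) z :=
      (differentiableAt_const b).div differentiableAt_id hz
    exact ((DifferentiableAt.comp z (differentiableAt_theta hp1 (mul_ne_zero hb hz)) h1).mul
      (DifferentiableAt.comp z (differentiableAt_theta hp1 (div_ne_zero hb hz))
        h2)).differentiableWithinAt
  symm z _ := by
    rw [mul_one_div, div_div_eq_mul_div, div_one, mul_comm]
  quasiPeriodic z hz := by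
    have h1 : b * (p * z) = p * (b * z) := by ring
    have h2 : b / (p * z) = b / z / p := by field_simp
    rw [h1, h2, theta_mul_left hp0 hp1 (mul_ne_zero hb hz),
      theta_div_left hp0 hp1 (div_ne_zero hb hz)]
    field_simp
    ring

end IsSymmTheta

/-! ### Lagrange interpolation of theta functions -/

/-- If the space of symmetric theta functions of degree `n` contains functions dual to the
evaluations at `n + 1` nodes, then these functions span it, so that a function vanishing at the
nodes is zero. -/
lemma IsSymmTheta.eq_zero_of_nodes {p : ℂ} {n : ℕ} {F : ℂ → ℂ} (hp0 : p ≠ 0) (hp1 : ‖p‖ < 1)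
    (hF : IsSymmTheta p n F) {x : Fin (n + 1) → ℂ} (hx : ∀ k, x k ≠ 0)
    {φ : Fin (n + 1) → ℂ → ℂ} (hφ : ∀ k, IsSymmTheta p n (φ k))
    (hφx : ∀ k j, φ k (x j) = if k = j then 1 else 0)
    (hFx : ∀ k, F (x k) = 0) {z : ℂ} (hz : z ≠ 0) : F z = 0 := by
  have hcomb : ∀ β : Fin (n + 1) → ℂ, IsSymmTheta p n (fun z => ∑ k, β k * φ k z) := fun β =>
    IsSymmTheta.sum _ fun k _ => (hφ k).const_mul (β k)
  have hev : ∀ (β : Fin (n + 1) → ℂ) j, ∑ k, β k * φ k (x j) = β j := fun β j => by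
    simp [hφx]
  have hint : ∀ {G : ℂ → ℂ}, IsSymmTheta p n G → ∀ j : ℤ, IntervalIntegrable
      (fun t => circleMap 0 1 t ^ (-j) * G (circleMap 0 1 t)) MeasureTheory.volume 0
        (2 * Real.pi) := fun {G} hG j => by
    refine Continuous.intervalIntegrable ?_ _ _
    have hne : ∀ t, circleMap 0 1 t ≠ 0 := fun t => circleMap_ne_center one_ne_zero
    exact ((continuous_circleMap 0 1).zpow₀ _ fun t => Or.inl (hne t)).mul
      (hG.holomorphic.continuousOn.comp_continuous (continuous_circleMap 0 1) hne)
  have hadd : ∀ {G H : ℂ → ℂ}, IsSymmTheta p n G → IsSymmTheta p n H → ∀ j : ℤ,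
      laurentCoeff (fun z => G z + H z) 1 j = laurentCoeff G 1 j + laurentCoeff H 1 j :=
    fun hG hH j => by
      simp only [laurentCoeff, mul_add]
      exact intervalIntegral.integral_add (hint hG j) (hint hH j)
  have hmul : ∀ (b : ℂ) (G : ℂ → ℂ) (j : ℤ),
      laurentCoeff (fun z => b * G z) 1 j = b * laurentCoeff G 1 j := fun b G j => by
    simp only [laurentCoeff, ← intervalIntegral.integral_const_mul, mul_left_comm]
  -- The map from coordinates in the dual family to Laurent coefficients is injective, so it is
  -- surjective for dimension reasons, and `F` is a combination of the `φ k`.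
  let Λ : (Fin (n + 1) → ℂ) →ₗ[ℂ] (Fin (n + 1) → ℂ) :=
    { toFun := fun β j => laurentCoeff (fun z => ∑ k, β k * φ k z) 1 (j : ℕ)
      map_add' := fun β γ => by
        funext j
        simp only [Pi.add_apply, add_mul, Finset.sum_add_distrib]
        exact hadd (hcomb β) (hcomb γ) _
      map_smul' := fun b β => by
        funext j
        simp only [Pi.smul_apply, smul_eq_mul, mul_assoc, ← Finset.mul_sum, RingHom.id_apply]
        exact hmul b _ _ }
  have hinj : Function.Injective Λ := by
    refine (injective_iff_map_eq_zero Λ).2 fun β hβ => funext fun j => ?_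
    rw [← hev β j]
    exact (hcomb β).eq_zero_of_laurentCoeff hp0 hp1 (fun i => congrFun hβ i) (hx j)
  obtain ⟨β, hβ⟩ := LinearMap.injective_iff_surjective.1 hinj
    fun j : Fin (n + 1) => laurentCoeff F 1 (j : ℕ)
  have hzero : ∀ {w : ℂ}, w ≠ 0 → F w + -1 * ∑ k, β k * φ k w = 0 := fun hw => by
    refine (hF.add ((hcomb β).const_mul (-1))).eq_zero_of_laurentCoeff hp0 hp1 (fun j => ?_) hw
    rw [hadd hF ((hcomb β).const_mul (-1)), hmul]
    have : laurentCoeff (fun z => ∑ k, β k * φ k z) 1 (j : ℕ) = laurentCoeff F 1 (j : ℕ) :=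
      congrFun hβ j
    rw [this]
    ring
  have hβ0 : ∀ j, β j = 0 := fun j => by
    have := hzero (hx j)
    rw [hev, hFx] at this
    linear_combination -this
  have := hzero hz
  simpa [hβ0] using this

/-- The Lagrange basis function attached to the node `a q^k` among the nodes `a q^j`,
`0 ≤ j ≤ n`, in the space of symmetric theta functions of degree `n`. -/
def lagrangeTheta (q p a : ℂ) (n k : ℕ) (z : ℂ) : ℂ :=
  ∏ j ∈ (Finset.range (n + 1)).erase k,
    theta p (a * q ^ j * z) * theta p (a * q ^ j / z) /
      (theta p (a * q ^ j * (a * q ^ k)) * theta p (a * q ^ j / (a * q ^ k)))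

/-- The nodes `a q^j`, `0 ≤ j ≤ n`, are pairwise inequivalent modulo `z ↦ p z` and `z ↦ 1 / z`,
expressed by the nonvanishing of the denominators of the Lagrange basis functions. -/
structure SeparatedNodes (q p a : ℂ) (n : ℕ) : Prop where
  ne_zero : a ≠ 0
  mul_ne_zero : ∀ j ≤ n, ∀ k ≤ n, j ≠ k → theta p (a * q ^ j * (a * q ^ k)) ≠ 0
  div_ne_zero : ∀ j ≤ n, ∀ k ≤ n, j ≠ k → theta p (a * q ^ j / (a * q ^ k)) ≠ 0

lemma isSymmTheta_lagrangeTheta {q p a : ℂ} (hq : q ≠ 0) (hp0 : p ≠ 0) (hp1 : ‖p‖ < 1)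
    (ha : a ≠ 0) {n k : ℕ} (hk : k ≤ n) : IsSymmTheta p n (lagrangeTheta q p a n k) := by
  have hcard : ((Finset.range (n + 1)).erase k).card = n := by
    rw [Finset.card_erase_of_mem (Finset.mem_range.2 (by omega)), Finset.card_range]
    rfl
  have h := IsSymmTheta.prod (p := p) ((Finset.range (n + 1)).erase k)
    (φ := fun j z => (theta p (a * q ^ j * (a * q ^ k)) * theta p (a * q ^ j / (a * q ^ k)))⁻¹ *
      (theta p (a * q ^ j * z) * theta p (a * q ^ j / z)))
    fun j _ => (IsSymmTheta.theta_mul_theta_div hp0 hp1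
      (mul_ne_zero ha (pow_ne_zero j hq))).const_mul _
  rw [hcard] at h
  convert! h using 2 with z
  rw [lagrangeTheta]
  exact Finset.prod_congr rfl fun j _ => by rw [div_eq_inv_mul]

lemma lagrangeTheta_node {q p a : ℂ} (hq : q ≠ 0) (hp1 : ‖p‖ < 1) {n : ℕ}
    (ha : SeparatedNodes q p a n) {k j : ℕ} (hk : k ≤ n) (hj : j ≤ n) :
    lagrangeTheta q p a n k (a * q ^ j) = if k = j then 1 else 0 := by
  rw [lagrangeTheta]
  split_ifs with h
  · subst h
    refine Finset.prod_eq_one fun i hi => div_self ?_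
    rw [Finset.mem_erase, Finset.mem_range] at hi
    exact mul_ne_zero (ha.mul_ne_zero i (by omega) k hk hi.1) (ha.div_ne_zero i (by omega) k hk hi.1)
  · refine Finset.prod_eq_zero (i := j) (by simp; omega) ?_
    rw [div_self (mul_ne_zero ha.ne_zero (pow_ne_zero j hq)), theta_one hp1, mul_zero, zero_div]

lemma IsSymmTheta.eq_zero_of_geometric_nodes {q p a : ℂ} (hq : q ≠ 0) (hp0 : p ≠ 0)
    (hp1 : ‖p‖ < 1) {n : ℕ} (ha : SeparatedNodes q p a n) {F : ℂ → ℂ} (hF : IsSymmTheta p n F)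
    (hFa : ∀ k ≤ n, F (a * q ^ k) = 0) {z : ℂ} (hz : z ≠ 0) : F z = 0 := by
  refine hF.eq_zero_of_nodes hp0 hp1 (x := fun k => a * q ^ (k : ℕ))
    (φ := fun k => lagrangeTheta q p a n k)
    (fun k => mul_ne_zero ha.ne_zero (pow_ne_zero _ hq))
    (fun k => isSymmTheta_lagrangeTheta hq hp0 hp1 ha.ne_zero (Nat.lt_succ_iff.1 k.2))
    (fun k j => ?_) (fun k => hFa k (Nat.lt_succ_iff.1 k.2)) hz
  rw [lagrangeTheta_node hq hp1 ha (Nat.lt_succ_iff.1 k.2) (Nat.lt_succ_iff.1 j.2)]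
  simp [Fin.ext_iff]

/-! ### Theta functions of several variables -/

lemma update_ne_zero {m : ℕ} {z : Fin m → ℂ} (hz : ∀ i, z i ≠ 0) (i : Fin m) {w : ℂ} (hw : w ≠ 0)
    (j : Fin m) : Function.update z i w j ≠ 0 := by
  rcases eq_or_ne j i with rfl | h
  · simpa using hw
  · simpa [h] using hz j

namespace IsThetaFunction

variable {m : ℕ} {p : ℂ} {n : Fin m → ℕ} {G H : (Fin m → ℂ) → ℂ}

/-- A theta function is a symmetric theta function in each variable separately. -/
lemma slice (hG : IsThetaFunction p n G) {z : Fin m → ℂ} (hz : ∀ i, z i ≠ 0) (i : Fin m) :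
    IsSymmTheta p (n i) (fun w => G (Function.update z i w)) where
  holomorphic := hG.holomorphic.comp
    (fun w _ => (hasFDerivAt_update z w).differentiableAt.differentiableWithinAt)
    fun w hw j => update_ne_zero hz i hw j
  symm w hw := by
    have h := hG.symm _ (update_ne_zero hz i hw) i
    simpa using h
  quasiPeriodic w hw := by
    have h := hG.quasiPeriodic _ (update_ne_zero hz i hw) i
    simpa using h

lemma zero : IsThetaFunction p n (fun _ => 0) :=
  ⟨differentiableOn_const _, by simp, by simp⟩

lemma add (hG : IsThetaFunction p n G) (hH : IsThetaFunction p n H) :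
    IsThetaFunction p n (fun z => G z + H z) where
  holomorphic := hG.holomorphic.add hH.holomorphic
  symm z hz i := by rw [hG.symm z hz, hH.symm z hz]
  quasiPeriodic z hz i := by rw [hG.quasiPeriodic z hz, hH.quasiPeriodic z hz, mul_add]

lemma const_mul (hG : IsThetaFunction p n G) (b : ℂ) : IsThetaFunction p n (fun z => b * G z) where
  holomorphic := hG.holomorphic.const_mul b
  symm z hz i := by rw [hG.symm z hz]
  quasiPeriodic z hz i := by rw [hG.quasiPeriodic z hz, mul_left_comm]

lemma mul {k l : Fin m → ℕ} (hG : IsThetaFunction p k G) (hH : IsThetaFunction p l H) :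
    IsThetaFunction p (fun i => k i + l i) (fun z => G z * H z) where
  holomorphic := hG.holomorphic.mul hH.holomorphic
  symm z hz i := by rw [hG.symm z hz, hH.symm z hz]
  quasiPeriodic z hz i := by
    rw [hG.quasiPeriodic z hz, hH.quasiPeriodic z hz, pow_add, mul_add, pow_add]
    simp only [one_div, mul_inv]
    ring

lemma sum {ι : Type*} (s : Finset ι) {φ : ι → (Fin m → ℂ) → ℂ}
    (h : ∀ i ∈ s, IsThetaFunction p n (φ i)) : IsThetaFunction p n (fun z => ∑ i ∈ s, φ i z) := by
  classical
  induction s using Finset.induction_on with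
  | empty => simpa using zero
  | insert i s hi ih =>
    simp only [Finset.sum_insert hi]
    exact (h i (Finset.mem_insert_self i s)).add
      (ih fun j hj => h j (Finset.mem_insert_of_mem hj))

lemma prod_coord {φ : Fin m → ℂ → ℂ} (hφ : ∀ i, IsSymmTheta p (n i) (φ i)) :
    IsThetaFunction p n (fun z => ∏ i, φ i (z i)) := by
  have hupd : ∀ (z : Fin m → ℂ) (i : Fin m) (w b : ℂ), φ i w = b * φ i (z i) →
      ∏ j, φ j (Function.update z i w j) = b * ∏ j, φ j (z j) := fun z i w b h => by
    rw [← Finset.mul_prod_erase _ _ (Finset.mem_univ i),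
      ← Finset.mul_prod_erase _ (fun j => φ j (z j)) (Finset.mem_univ i), ← mul_assoc, ← h]
    congr 1
    · simp
    · refine Finset.prod_congr rfl fun j hj => ?_
      rw [Function.update_of_ne (Finset.ne_of_mem_erase hj)]
  refine ⟨?_, fun z hz i => ?_, fun z hz i => ?_⟩
  · have hd : ∀ i ∈ (Finset.univ : Finset (Fin m)), DifferentiableOn ℂ (fun z : Fin m → ℂ => φ i (z i))
        {z | ∀ i, z i ≠ 0} := fun i _ => by
      have hi : DifferentiableOn ℂ (fun z : Fin m → ℂ => z i) {z | ∀ i, z i ≠ 0} :=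
        (differentiable_apply i).differentiableOn
      exact (hφ i).holomorphic.comp hi fun z (hz : ∀ i, z i ≠ 0) => hz i
    exact fun z hz => (HasFDerivWithinAt.finsetProd fun i hi =>
      (hd i hi z hz).hasFDerivWithinAt).differentiableWithinAt
  · simpa using hupd z i (1 / z i) 1 (by rw [(hφ i).symm _ (hz i), one_mul])
  · exact hupd z i _ _ ((hφ i).quasiPeriodic _ (hz i))

/-- A theta function vanishing on the grid of nodes is zero: the coordinates are released from the
grid one at a time. -/
lemma eq_zero_of_grid {q : ℂ} {a : Fin m → ℂ} (hq : q ≠ 0) (hp0 : p ≠ 0) (hp1 : ‖p‖ < 1)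
    (ha : ∀ i, SeparatedNodes q p (a i) (n i)) (hG : IsThetaFunction p n G)
    (hGa : ∀ k : Fin m → ℕ, (∀ i, k i ≤ n i) → G (fun i => a i * q ^ k i) = 0)
    {z : Fin m → ℂ} (hz : ∀ i, z i ≠ 0) : G z = 0 := by
  suffices h : ∀ (S : Finset (Fin m)) (z : Fin m → ℂ), (∀ i, z i ≠ 0) →
      (∀ i, i ∉ S → ∃ k ≤ n i, z i = a i * q ^ k) → G z = 0 from
    h Finset.univ z hz fun i hi => absurd (Finset.mem_univ i) hi
  intro S
  induction S using Finset.induction_on with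
  | empty =>
    intro z _ h
    choose k hk hzk using fun i => h i (Finset.notMem_empty i)
    rw [funext hzk]
    exact hGa k hk
  | insert i S _ ih =>
    intro z hz h
    have hslice := (hG.slice hz i).eq_zero_of_geometric_nodes hq hp0 hp1 (ha i)
      (fun k hk => ih _ (update_ne_zero hz i (mul_ne_zero (ha i).ne_zero (pow_ne_zero k hq)))
        fun j hj => ?_) (hz i)
    · rwa [Function.update_eq_self] at hslice
    · rcases eq_or_ne j i with rfl | hji
      · exact ⟨k, hk, by simp⟩
      · simpa [hji] using h j (by simp [hji, hj])

/-- Lagrange expansion: both sides are theta functions that agree on the grid of nodes. -/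
lemma eq_sum_lagrangeTheta {q : ℂ} {a : Fin m → ℂ} (hq : q ≠ 0) (hp0 : p ≠ 0) (hp1 : ‖p‖ < 1)
    (ha : ∀ i, SeparatedNodes q p (a i) (n i)) (hG : IsThetaFunction p n G)
    {z : Fin m → ℂ} (hz : ∀ i, z i ≠ 0) :
    G z = ∑ k ∈ Fintype.piFinset (fun i => Finset.range (n i + 1)),
      (∏ i, lagrangeTheta q p (a i) (n i) (k i) (z i)) * G (fun i => a i * q ^ k i) := by
  set s := Fintype.piFinset fun i => Finset.range (n i + 1) with hs
  have hle : ∀ {k}, k ∈ s → ∀ i, k i ≤ n i := fun hk i =>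
    Nat.lt_succ_iff.1 (Finset.mem_range.1 (Fintype.mem_piFinset.1 hk i))
  have hL : IsThetaFunction p n fun z => ∑ k ∈ s, G (fun i => a i * q ^ k i) *
      ∏ i, lagrangeTheta q p (a i) (n i) (k i) (z i) :=
    sum s fun k hk => (prod_coord fun i =>
      isSymmTheta_lagrangeTheta hq hp0 hp1 (ha i).ne_zero (hle hk i)).const_mul _
  have h := (hG.add (hL.const_mul (-1))).eq_zero_of_grid hq hp0 hp1 ha (fun l hl => ?_) hz
  · simp only [mul_comm (G _)] at h
    linear_combination h
  · have hls : l ∈ s := Fintype.mem_piFinset.2 fun i => Finset.mem_range.2 (Nat.lt_succ_iff.2 (hl i))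
    rw [Finset.sum_eq_single_of_mem l hls fun k hk hkl => ?_, Finset.prod_eq_one fun i _ => ?_]
    · ring
    · rw [lagrangeTheta_node hq hp1 (ha i) (hl i) (hl i), if_pos rfl]
    · obtain ⟨i, hi⟩ := Function.ne_iff.1 hkl
      rw [Finset.prod_eq_zero (Finset.mem_univ i), mul_zero]
      rw [lagrangeTheta_node hq hp1 (ha i) (hle hk i) (hl i), if_neg hi]

end IsThetaFunction

/-! ### Theta shifted factorials -/

lemma thetaFac_add (q p a : ℂ) (k l : ℕ) :
    thetaFac q p a (k + l) = thetaFac q p a k * thetaFac q p (a * q ^ k) l := by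
  simp only [thetaFac, Finset.prod_range_add, pow_add, mul_assoc]

lemma thetaFac_ne_zero_of_le {q p a : ℂ} {k n : ℕ} (hk : k ≤ n) (h : thetaFac q p a n ≠ 0) :
    thetaFac q p a k ≠ 0 := by
  obtain ⟨l, rfl⟩ := Nat.exists_eq_add_of_le hk
  rw [thetaFac_add] at h
  exact left_ne_zero_of_mul h

lemma theta_ne_zero_of_thetaFac {q p a : ℂ} {k n : ℕ} (hk : k < n) (h : thetaFac q p a n ≠ 0) :
    theta p (a * q ^ k) ≠ 0 :=
  Finset.prod_ne_zero_iff.1 h k (Finset.mem_range.2 hk)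

/-- Reversal of a theta shifted factorial by `θ(x;p) = -x θ(1/x;p)`. The hypothesis says
`b' = q^{1-k} / b`. -/
lemma thetaFac_reverse {q p b b' : ℂ} {k : ℕ} (hp1 : ‖p‖ < 1) (hq : q ≠ 0) (hb : b ≠ 0)
    (h : b * b' * q ^ k = q) :
    thetaFac q p b k = (∏ j ∈ Finset.range k, -(b * q ^ j)) * thetaFac q p b' k := by
  rw [thetaFac, thetaFac, ← Finset.prod_range_reflect (fun j => theta p (b' * q ^ j)),
    ← Finset.prod_mul_distrib]
  refine Finset.prod_congr rfl fun j hj => ?_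
  have hjk := Finset.mem_range.1 hj
  rw [theta_eq_neg_mul_theta_inv hp1 (mul_ne_zero hb (pow_ne_zero j hq))]
  congr 2
  refine inv_eq_of_mul_eq_one_right ?_
  have hk : q ^ k = q ^ j * q ^ (k - 1 - j) * q := by
    rw [← pow_add, ← pow_succ]
    congr 1
    omega
  rw [hk] at h
  apply mul_right_cancel₀ hq
  linear_combination h

lemma prod_erase_range_theta (q p b : ℂ) {n k : ℕ} (hk : k ≤ n) :
    ∏ j ∈ (Finset.range (n + 1)).erase k, theta p (b * q ^ j) =
      thetaFac q p b k * thetaFac q p (b * q ^ (k + 1)) (n - k) := by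
  have h : (Finset.range (n + 1)).erase k = Finset.range k ∪ Finset.Ico (k + 1) (n + 1) := by
    ext j
    simp only [Finset.mem_erase, Finset.mem_range, Finset.mem_union, Finset.mem_Ico]
    omega
  have hd : Disjoint (Finset.range k) (Finset.Ico (k + 1) (n + 1)) := by
    rw [Finset.disjoint_left]
    intro j hj hj'
    simp only [Finset.mem_range, Finset.mem_Ico] at hj hj'
    omega
  rw [h, Finset.prod_union hd, Finset.prod_Ico_eq_prod_range, thetaFac, thetaFac,
    Nat.add_sub_add_right]
  simp only [pow_add, mul_assoc]

/-! ### Evaluation of the interpolation coefficients -/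

lemma prod_erase_div_thetaFac {q p b : ℂ} {n k : ℕ} (hk : k ≤ n)
    (h : thetaFac q p (b * q) n ≠ 0) :
    (∏ j ∈ (Finset.range (n + 1)).erase k, theta p (b * q ^ j)) / thetaFac q p (b * q) n =
      thetaFac q p b k / thetaFac q p (b * q) k := by
  obtain ⟨l, rfl⟩ := Nat.exists_eq_add_of_le hk
  rw [prod_erase_range_theta q p b hk, Nat.add_sub_cancel_left]
  have hs := thetaFac_add q p (b * q) k l
  rw [show b * q * q ^ k = b * q ^ (k + 1) by ring] at hs
  rw [hs] at h ⊢
  have h1 := left_ne_zero_of_mul h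
  have h2 := right_ne_zero_of_mul h
  field_simp

lemma thetaFac_shift_div (q p b : ℂ) {n k : ℕ} (hk : k ≤ n) (h : thetaFac q p b n ≠ 0) :
    thetaFac q p (b * q ^ k) n / thetaFac q p b n =
      thetaFac q p (b * q ^ n) k / thetaFac q p b k := by
  rw [div_eq_div_iff h (thetaFac_ne_zero_of_le hk h), mul_comm, ← thetaFac_add, add_comm k n,
    thetaFac_add, mul_comm]

lemma thetaFac_div_shift_div {q p a c : ℂ} (hp1 : ‖p‖ < 1) (hq : q ≠ 0) (ha : a ≠ 0) (hc : c ≠ 0)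
    {n k : ℕ} (hk : k ≤ n) (h : thetaFac q p (c / a) n ≠ 0) :
    q ^ (n * k) * (thetaFac q p (c / (a * q ^ k)) n / thetaFac q p (c / a) n) =
      thetaFac q p (a * q / c) k / thetaFac q p (a * q ^ (1 - (n : ℤ)) / c) k := by
  obtain ⟨l, rfl⟩ := Nat.exists_eq_add_of_le hk
  have hqz : q ^ (1 - ((k + l : ℕ) : ℤ)) = q / q ^ (k + l) := by
    rw [zpow_sub₀ hq, zpow_one, zpow_natCast]
  have h1 := thetaFac_reverse (p := p) (k := k) (b := a * q / c) (b' := c / (a * q ^ k)) hp1 hq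
    (by positivity) (by field_simp)
  have h2 := thetaFac_reverse (p := p) (k := k) (b := a * (q / q ^ (k + l)) / c)
    (b' := c / a * q ^ l) hp1 hq (by positivity) (by field_simp; ring)
  have h3 := thetaFac_add q p (c / (a * q ^ k)) k l
  have h4 := thetaFac_add q p (c / a) l k
  rw [show c / (a * q ^ k) * q ^ k = c / a by field_simp] at h3
  rw [add_comm l k] at h4
  have hscale : ∏ j ∈ Finset.range k, -(a * q / c * q ^ j) =
      q ^ ((k + l) * k) * ∏ j ∈ Finset.range k, -(a * (q / q ^ (k + l)) / c * q ^ j) := by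
    rw [pow_mul, ← Finset.card_range k, ← Finset.prod_const, Finset.card_range,
      ← Finset.prod_mul_distrib]
    refine Finset.prod_congr rfl fun j _ => ?_
    field_simp
  have hne : ∏ j ∈ Finset.range k, -(a * (q / q ^ (k + l)) / c * q ^ j) ≠ 0 :=
    Finset.prod_ne_zero_iff.2 fun j _ => neg_ne_zero.2 (by positivity)
  rw [hqz, h1, h2, h3, h4, hscale]
  rw [h4] at h
  have h5 := left_ne_zero_of_mul h
  have h6 := right_ne_zero_of_mul h
  generalize (∏ j ∈ Finset.range k, -(a * (q / q ^ (k + l)) / c * q ^ j)) = P at *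
  field_simp

lemma thetaFac_div_prod_mul {q p a : ℂ} {n k : ℕ} (hk : k ≤ n) (ha : theta p (a ^ 2) ≠ 0)
    (hprod : ∏ j ∈ (Finset.range (n + 1)).erase k, theta p (a * q ^ j * (a * q ^ k)) ≠ 0)
    (h : thetaFac q p (a ^ 2 * q ^ (n + 1)) n ≠ 0) :
    thetaFac q p (a ^ 2 * q) n /
        ∏ j ∈ (Finset.range (n + 1)).erase k, theta p (a * q ^ j * (a * q ^ k)) =
      theta p (a ^ 2 * q ^ (2 * k)) / theta p (a ^ 2) *
        (thetaFac q p (a ^ 2) k / thetaFac q p (a ^ 2 * q ^ (n + 1)) k) := by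
  have hfun : ∀ j, a * q ^ j * (a * q ^ k) = a ^ 2 * q ^ k * q ^ j := fun j => by ring
  simp only [hfun] at hprod ⊢
  rw [prod_erase_range_theta q p _ hk] at hprod ⊢
  have h1 := thetaFac_ne_zero_of_le hk h
  rw [div_mul_div_comm, div_eq_div_iff hprod (mul_ne_zero ha h1)]
  -- Both sides equal `(a²;q,p)_{n+k+1}`.
  have e1 : thetaFac q p (a ^ 2) (1 + n + k) =
      theta p (a ^ 2) * thetaFac q p (a ^ 2 * q) n * thetaFac q p (a ^ 2 * q ^ (n + 1)) k := by
    rw [thetaFac_add, thetaFac_add, add_comm 1 n, pow_one]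
    simp [thetaFac]
  have e2 : thetaFac q p (a ^ 2) (k + k + 1 + (n - k)) =
      thetaFac q p (a ^ 2) k * thetaFac q p (a ^ 2 * q ^ k) k * theta p (a ^ 2 * q ^ (2 * k)) *
        thetaFac q p (a ^ 2 * q ^ k * q ^ (k + 1)) (n - k) := by
    rw [thetaFac_add, thetaFac_add, thetaFac_add, show a ^ 2 * q ^ k * q ^ (k + 1) =
      a ^ 2 * q ^ (k + k + 1) by ring, ← two_mul]
    simp [thetaFac]
  rw [show k + k + 1 + (n - k) = 1 + n + k by omega] at e2
  linear_combination e2 - e1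

/-- Reversing `(q^{-k};q,p)_k` and `(q^{-n};q,p)_k` produces the powers of `q`; the factor
`q^{nk}` is the one that `thetaFac_div_shift_div` absorbs. -/
lemma thetaFac_div_prod_div {q p a : ℂ} (hp1 : ‖p‖ < 1) (hq : q ≠ 0) (ha : a ≠ 0)
    {n k : ℕ} (hk : k ≤ n) (h : thetaFac q p q n ≠ 0) :
    thetaFac q p q n /
        ∏ j ∈ (Finset.range (n + 1)).erase k, theta p (a * q ^ j / (a * q ^ k)) =
      q ^ k * q ^ (n * k) * (thetaFac q p (q ^ (-(n : ℤ))) k / thetaFac q p q k) := by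
  have hfun : ∀ j, a * q ^ j / (a * q ^ k) = (q ^ k)⁻¹ * q ^ j := fun j => by field_simp
  simp only [hfun]
  rw [prod_erase_range_theta q p _ hk]
  obtain ⟨l, rfl⟩ := Nat.exists_eq_add_of_le hk
  rw [Nat.add_sub_cancel_left, show (q ^ k)⁻¹ * q ^ (k + 1) = q by rw [pow_succ]; field_simp,
    zpow_neg, zpow_natCast]
  have h1 := thetaFac_reverse (p := p) (k := k) (b := (q ^ k)⁻¹) (b' := q) hp1 hq
    (by positivity) (by field_simp)
  have h2 := thetaFac_reverse (p := p) (k := k) (b := (q ^ (k + l))⁻¹)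
    (b' := q * q ^ l) hp1 hq (by positivity) (by field_simp; ring)
  have h3 := thetaFac_add q p q l k
  rw [add_comm l k] at h3
  -- The powers of `q` from the two reversals cancel: reflecting one product makes each factor
  -- of the combined product equal to `q ^ (-n - 1)`.
  have hscale : q ^ k * q ^ ((k + l) * k) * ((∏ j ∈ Finset.range k, -((q ^ (k + l))⁻¹ * q ^ j)) *
      ∏ j ∈ Finset.range k, -((q ^ k)⁻¹ * q ^ j)) = 1 := by
    rw [← Finset.prod_range_reflect (fun j => -((q ^ k)⁻¹ * q ^ j)), ← Finset.prod_mul_distrib,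
      pow_mul, ← mul_pow]
    nth_rewrite 2 [← Finset.card_range k]
    rw [← Finset.prod_const, ← Finset.prod_mul_distrib]
    refine Finset.prod_eq_one fun j hj => ?_
    have hk' : q ^ k = q ^ j * q ^ (k - 1 - j) * q := by
      rw [← pow_add, ← pow_succ]
      congr 1
      have := Finset.mem_range.1 hj
      omega
    field_simp
    rw [hk']
    ring
  have hk0 : thetaFac q p q k ≠ 0 := thetaFac_ne_zero_of_le hk h
  have hl0 : thetaFac q p q l ≠ 0 := thetaFac_ne_zero_of_le (Nat.le_add_left l k) h
  rw [h1, h2, h3]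
  have hne := right_ne_zero_of_mul (right_ne_zero_of_mul (hscale.trans_ne one_ne_zero))
  rw [div_eq_iff (by positivity)]
  generalize (∏ j ∈ Finset.range k, -((q ^ (k + l))⁻¹ * q ^ j)) = P at *
  generalize (∏ j ∈ Finset.range k, -((q ^ k)⁻¹ * q ^ j)) = Q at *
  field_simp
  linear_combination (-thetaFac q p (q * q ^ l) k) * hscale

/-- The Lagrange basis function, multiplied by the denominator at its node and by the prefactor of
the interpolation formula, is the summand of that formula. -/
lemma lagrangeTheta_coefficient {q p a c z : ℂ} (hp1 : ‖p‖ < 1) (hq : q ≠ 0) (hc : c ≠ 0)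
    {n k : ℕ} (hk : k ≤ n) (ha : SeparatedNodes q p a n) (ha2 : theta p (a ^ 2) ≠ 0)
    (hdq : thetaFacs q p [q, a ^ 2 * q ^ (n + 1)] n ≠ 0)
    (hdc : thetaFacs q p [a * c, c / a] n ≠ 0)
    (hdz : thetaFacs q p [a * q * z, a * q / z] n ≠ 0) :
    thetaFacs q p [a ^ 2 * q, q] n / thetaFacs q p [a * c, c / a, a * q * z, a * q / z] n *
        thetaFacs q p [c * (a * q ^ k), c / (a * q ^ k)] n * lagrangeTheta q p a n k z =
      q ^ k * (theta p (a ^ 2 * q ^ (2 * k)) / theta p (a ^ 2)) *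
        (thetaFacs q p [q ^ (-(n : ℤ)), a ^ 2, a * q / c, a * c * q ^ n, a * z, a / z] k /
          thetaFacs q p [q, a ^ 2 * q ^ (n + 1), a * c, a * q ^ (1 - (n : ℤ)) / c,
            a * q * z, a * q / z] k) := by
  simp only [thetaFacs, List.map_cons, List.map_nil, List.prod_cons, List.prod_nil, mul_one,
    mul_ne_zero_iff] at hdq hdc hdz ⊢
  have hz1 : a * q * z = a * z * q := by ring
  have hz2 : a * q / z = a / z * q := by ring
  rw [hz1, hz2] at hdz ⊢
  have r1 := thetaFac_shift_div q p (a * c) hk hdc.1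
  have r2 := thetaFac_div_shift_div hp1 hq ha.ne_zero hc hk hdc.2
  have r3 := prod_erase_div_thetaFac hk hdz.1
  have r4 := prod_erase_div_thetaFac hk hdz.2
  have r5 := thetaFac_div_prod_mul hk ha2 (Finset.prod_ne_zero_iff.2 fun j hj => by
    rw [Finset.mem_erase, Finset.mem_range] at hj
    exact ha.mul_ne_zero j (by omega) k hk hj.1) hdq.2
  have r6 := thetaFac_div_prod_div hp1 hq ha.ne_zero hk hdq.1
  have hL : lagrangeTheta q p a n k z =
      (∏ j ∈ (Finset.range (n + 1)).erase k, theta p (a * z * q ^ j)) *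
      (∏ j ∈ (Finset.range (n + 1)).erase k, theta p (a / z * q ^ j)) /
      ((∏ j ∈ (Finset.range (n + 1)).erase k, theta p (a * q ^ j * (a * q ^ k))) *
      ∏ j ∈ (Finset.range (n + 1)).erase k, theta p (a * q ^ j / (a * q ^ k))) := by
    rw [lagrangeTheta, Finset.prod_div_distrib, Finset.prod_mul_distrib, Finset.prod_mul_distrib]
    simp only [mul_right_comm a (q ^ _) z, mul_div_right_comm a (q ^ _) z]
  rw [hL, show c * (a * q ^ k) = a * c * q ^ k by ring]
  have hqn : q ^ (n * k) ≠ 0 := pow_ne_zero _ hq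
  apply mul_left_cancel₀ hqn
  have key := congrArg₂ (· * ·) (congrArg₂ (· * ·) (congrArg₂ (· * ·) r1 r2)
    (congrArg₂ (· * ·) r3 r4)) (congrArg₂ (· * ·) r5 r6)
  simp only [div_eq_mul_inv, mul_inv] at key ⊢
  linear_combination key

/-! ### The interpolation formula at generic points -/

lemma thetaFacs_pair (q p c w : ℂ) (n : ℕ) :
    thetaFacs q p [c * w, c / w] n =
      ∏ j ∈ Finset.range n, theta p (c * q ^ j * w) * theta p (c * q ^ j / w) := by
  simp only [thetaFacs, List.map_cons, List.map_nil, List.prod_cons, List.prod_nil, mul_one,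
    thetaFac, Finset.prod_mul_distrib, mul_right_comm c (q ^ _) w, mul_div_right_comm c (q ^ _) w]

lemma thetaFacs_pair_add (q p c w : ℂ) (k l : ℕ) :
    thetaFacs q p [c * w, c / w] (k + l) = thetaFacs q p [c * w, c / w] k *
      thetaFacs q p [c * q ^ k * w, c * q ^ k / w] l := by
  simp only [thetaFacs_pair, Finset.prod_range_add, pow_add, ← mul_assoc]

lemma isSymmTheta_thetaFacs_pair {q p c : ℂ} (hq : q ≠ 0) (hp0 : p ≠ 0) (hp1 : ‖p‖ < 1)
    (hc : c ≠ 0) (n : ℕ) : IsSymmTheta p n (fun w => thetaFacs q p [c * w, c / w] n) := by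
  simp only [thetaFacs_pair]
  simpa using IsSymmTheta.prod (Finset.range n) fun j _ =>
    IsSymmTheta.theta_mul_theta_div hp0 hp1 (mul_ne_zero hc (pow_ne_zero j hq))

/-- Clearing the common denominator of an element of the span leaves a theta function. -/
lemma exists_isThetaFunction_of_mem_spanW {m : ℕ} {q p : ℂ} {c : Fin m → ℂ} {n : Fin m → ℕ}
    (hq : q ≠ 0) (hp0 : p ≠ 0) (hp1 : ‖p‖ < 1) (hc : ∀ i, c i ≠ 0) {h : (Fin m → ℂ) → ℂ}
    (hh : h ∈ spanW q p c n) :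
    ∃ G, IsThetaFunction p n G ∧ ∀ z : Fin m → ℂ,
      (∀ i, thetaFacs q p [c i * z i, c i / z i] (n i) ≠ 0) →
        (∏ i, thetaFacs q p [c i * z i, c i / z i] (n i)) * h z = G z := by
  induction hh using Submodule.span_induction with
  | mem f hf =>
    obtain ⟨k, g, hk, hg, rfl⟩ := hf
    choose l hl using fun i => Nat.exists_eq_add_of_le (hk i)
    obtain rfl : n = fun i => k i + l i := funext hl
    refine ⟨_, hg.mul (IsThetaFunction.prod_coord fun i =>
      isSymmTheta_thetaFacs_pair hq hp0 hp1 (mul_ne_zero (hc i) (pow_ne_zero (k i) hq)) (l i)),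
      fun z hz => ?_⟩
    simp only [thetaFacs_pair_add] at hz ⊢
    have hne : ∏ i, thetaFacs q p [c i * z i, c i / z i] (k i) ≠ 0 :=
      Finset.prod_ne_zero_iff.2 fun i _ => left_ne_zero_of_mul (hz i)
    rw [Finset.prod_mul_distrib]
    field_simp
  | zero => exact ⟨_, IsThetaFunction.zero, fun z _ => by simp⟩
  | add f g _ _ hf hg =>
    obtain ⟨F, hF, hFf⟩ := hf
    obtain ⟨G, hG, hGg⟩ := hg
    exact ⟨_, hF.add hG, fun z hz => by rw [Pi.add_apply, mul_add, hFf z hz, hGg z hz]⟩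
  | smul b f _ hf =>
    obtain ⟨F, hF, hFf⟩ := hf
    exact ⟨_, hF.const_mul b, fun z hz => by
      rw [Pi.smul_apply, smul_eq_mul, mul_left_comm, hFf z hz]⟩

/-- The prefactor of `f(z_1,…,z_m)` in the interpolation formula. -/
def interpPrefactor {m : ℕ} (q p : ℂ) (n : Fin m → ℕ) (c a z : Fin m → ℂ) : ℂ :=
  ∏ i, thetaFacs q p [a i ^ 2 * q, q, c i * z i, c i / z i] (n i) /
      thetaFacs q p [a i * c i, c i / a i, a i * q * z i, a i * q / z i] (n i)

/-- The coefficient of `f(a_1 q^{k_1},…,a_m q^{k_m})` in the interpolation formula. -/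
def interpCoeff {m : ℕ} (q p : ℂ) (n : Fin m → ℕ) (c : Fin m → ℂ) (k : Fin m → ℕ)
    (a z : Fin m → ℂ) : ℂ :=
  ∏ i, q ^ k i *
    (theta p (a i ^ 2 * q ^ (2 * k i)) / theta p (a i ^ 2)) *
    (thetaFacs q p
        [q ^ (-(n i : ℤ)), a i ^ 2, a i * q / c i, a i * c i * q ^ n i,
          a i * z i, a i / z i] (k i) /
      thetaFacs q p
        [q, a i ^ 2 * q ^ (n i + 1), a i * c i, a i * q ^ (1 - (n i : ℤ)) / c i,
          a i * q * z i, a i * q / z i] (k i))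

/-- The interpolation formula when all nodes are distinct and no denominator of `f` vanishes. -/
lemma interpolation_of_generic {m : ℕ} {q p : ℂ} (hq : q ≠ 0) (hp0 : p ≠ 0) (hp1 : ‖p‖ < 1)
    {n : Fin m → ℕ} {a c z : Fin m → ℂ} (hc : ∀ i, c i ≠ 0) (hz : ∀ i, z i ≠ 0)
    (ha : ∀ i, SeparatedNodes q p (a i) (n i))
    (hden_a : ∀ i, theta p (a i ^ 2) ≠ 0)
    (hden_q : ∀ i, thetaFacs q p [q, a i ^ 2 * q ^ (n i + 1)] (n i) ≠ 0)
    (hden_c : ∀ i, thetaFacs q p [a i * c i, c i / a i] (n i) ≠ 0)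
    (hden_z : ∀ i, thetaFacs q p [a i * q * z i, a i * q / z i] (n i) ≠ 0)
    (hcz : ∀ i, thetaFacs q p [c i * z i, c i / z i] (n i) ≠ 0)
    (hca : ∀ i, ∀ k ≤ n i, thetaFacs q p [c i * (a i * q ^ k), c i / (a i * q ^ k)] (n i) ≠ 0)
    {f : (Fin m → ℂ) → ℂ} (hf : f ∈ W q p c n) :
    interpPrefactor q p n c a z * f z =
      ∑ k ∈ Fintype.piFinset (fun i => Finset.range (n i + 1)),
        interpCoeff q p n c k a z * f (fun i => a i * q ^ k i) := by
  -- `f` agrees with the element `h` of the span only where the denominators do not vanish, which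
  -- here covers `z` and all nodes.
  obtain ⟨h, hh, hfh⟩ := hf
  obtain ⟨G, hG, hGh⟩ := exists_isThetaFunction_of_mem_spanW hq hp0 hp1 hc hh
  have hle : ∀ {k}, k ∈ Fintype.piFinset (fun i => Finset.range (n i + 1)) → ∀ i, k i ≤ n i :=
    fun hk i => Nat.lt_succ_iff.1 (Finset.mem_range.1 (Fintype.mem_piFinset.1 hk i))
  have hpre : interpPrefactor q p n c a z =
      (∏ i, thetaFacs q p [a i ^ 2 * q, q] (n i) /
        thetaFacs q p [a i * c i, c i / a i, a i * q * z i, a i * q / z i] (n i)) *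
      ∏ i, thetaFacs q p [c i * z i, c i / z i] (n i) := by
    rw [interpPrefactor, ← Finset.prod_mul_distrib]
    refine Finset.prod_congr rfl fun i _ => ?_
    simp only [thetaFacs, List.map_cons, List.map_nil, List.prod_cons, List.prod_nil]
    ring
  rw [hfh z fun i => ⟨hz i, hcz i⟩, hpre, mul_assoc, hGh z hcz,
    hG.eq_sum_lagrangeTheta hq hp0 hp1 ha hz, Finset.mul_sum]
  refine Finset.sum_congr rfl fun k hk => ?_
  have hca' := fun i => hca i (k i) (hle hk i)
  rw [hfh _ fun i => ⟨mul_ne_zero (ha i).ne_zero (pow_ne_zero _ hq), hca' i⟩, ← hGh _ hca',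
    ← mul_assoc, ← mul_assoc]
  congr 1
  rw [← Finset.prod_mul_distrib, ← Finset.prod_mul_distrib, interpCoeff]
  refine Finset.prod_congr rfl fun i _ => ?_
  rw [← lagrangeTheta_coefficient hp1 hq (hc i) (hle hk i) (ha i) (hden_a i) (hden_q i) (hden_c i)
    (hden_z i)]
  ring

/-! ### Passage to the limit -/

lemma continuousAt_theta_comp {X : Type*} [TopologicalSpace X] {p : ℂ} (hp1 : ‖p‖ < 1)
    {u : X → ℂ} {x : X} (hu : ContinuousAt u x) (hux : u x ≠ 0) :
    ContinuousAt (fun y => theta p (u y)) x :=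
  ContinuousAt.comp (g := theta p) (f := u) (differentiableAt_theta hp1 hux).continuousAt hu

lemma continuousAt_thetaFac {X : Type*} [TopologicalSpace X] {q p : ℂ} (hq : q ≠ 0)
    (hp1 : ‖p‖ < 1) {u : X → ℂ} {x : X} (hu : ContinuousAt u x) (hux : u x ≠ 0) (n : ℕ) :
    ContinuousAt (fun y => thetaFac q p (u y) n) x := by
  unfold thetaFac
  exact tendsto_finsetProd _ fun j _ => continuousAt_theta_comp hp1
    (hu.mul continuousAt_const) (mul_ne_zero hux (pow_ne_zero j hq))

lemma continuousAt_thetaFacs {X : Type*} [TopologicalSpace X] {q p : ℂ} (hq : q ≠ 0)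
    (hp1 : ‖p‖ < 1) {us : List (X → ℂ)} {x : X} (n : ℕ)
    (h : ∀ u ∈ us, ContinuousAt u x ∧ u x ≠ 0) :
    ContinuousAt (fun y => thetaFacs q p (us.map fun u => u y) n) x := by
  induction us with
  | nil => simpa [thetaFacs] using continuousAt_const
  | cons u us ih =>
    have hu := h u List.mem_cons_self
    have h1 := continuousAt_thetaFac hq hp1 hu.1 hu.2 n
    have h2 := ih fun v hv => h v (List.mem_cons_of_mem u hv)
    simp only [thetaFacs, List.map_cons, List.prod_cons] at h2 ⊢
    exact h1.mul h2

/-- The zeros of `θ` lie in the countable set of powers of `p`, so a map `u` with countable fibres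
pulls them back to a countable set. -/
lemma countable_preimage_theta_zeros {p : ℂ} (hp1 : ‖p‖ < 1) {u : ℂ → ℂ}
    (hu : ∀ y, (u ⁻¹' {y}).Countable) : {b | u b = 0 ∨ theta p (u b) = 0}.Countable := by
  have : {b | u b = 0 ∨ theta p (u b) = 0} =
      ⋃ y ∈ {x : ℂ | x = 0 ∨ theta p x = 0}, u ⁻¹' {y} := by
    ext b
    simp
  rw [this]
  exact (countable_theta_zeros hp1).biUnion fun y _ => hu y

lemma countable_mul_left_zeros {p d : ℂ} (hp1 : ‖p‖ < 1) (hd : d ≠ 0) :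
    {b | theta p (d * b) = 0}.Countable :=
  (countable_preimage_theta_zeros hp1 fun y =>
    ((Set.countable_singleton y).preimage_of_injOn
      (mul_right_injective₀ hd).injOn)).mono fun _ hb => Or.inr hb

lemma countable_div_zeros {p d : ℂ} (hp1 : ‖p‖ < 1) (hd : d ≠ 0) :
    {b | theta p (d / b) = 0}.Countable :=
  (countable_preimage_theta_zeros hp1 fun y =>
    ((Set.countable_singleton y).preimage_of_injOn fun b _ b' _ h => by
      simpa [div_eq_mul_inv, hd] using h)).mono fun _ hb => Or.inr hb

lemma countable_sq_mul_zeros {p d : ℂ} (hp1 : ‖p‖ < 1) (hd : d ≠ 0) :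
    {b | theta p (b ^ 2 * d) = 0}.Countable := by
  refine (countable_preimage_theta_zeros hp1 (u := fun b => b ^ 2 * d) fun y => ?_).mono
    fun _ hb => Or.inr hb
  by_cases h : ∃ b₀ : ℂ, b₀ ^ 2 * d = y
  · obtain ⟨b₀, rfl⟩ := h
    refine (Set.toFinite {b₀, -b₀}).countable.mono fun b hb => ?_
    have hb' : b ^ 2 * d = b₀ ^ 2 * d := hb
    exact sq_eq_sq_iff_eq_or_eq_neg.1 (mul_right_cancel₀ hd hb')
  · refine Set.countable_empty.mono fun b hb => h ⟨b, hb⟩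

lemma countable_thetaFacs_pair_zeros {q p c : ℂ} (hq : q ≠ 0) (hp1 : ‖p‖ < 1) (hc : c ≠ 0)
    (n : ℕ) : {w | thetaFacs q p [c * w, c / w] n = 0}.Countable := by
  have h : {w | thetaFacs q p [c * w, c / w] n = 0} ⊆
      ⋃ j : ℕ, ({w | theta p (c * q ^ j * w) = 0} ∪ {w | theta p (c * q ^ j / w) = 0}) := by
    intro w hw
    rw [Set.mem_ofPred_eq, thetaFacs_pair, Finset.prod_eq_zero_iff] at hw
    obtain ⟨j, _, hj⟩ := hw
    exact Set.mem_iUnion.2 ⟨j, mul_eq_zero.1 hj⟩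
  refine (Set.countable_iUnion fun j => ?_).mono h
  have hd := mul_ne_zero hc (pow_ne_zero j hq)
  exact (countable_mul_left_zeros hp1 hd).union (countable_div_zeros hp1 hd)

lemma theta_pow_div_pow_ne_zero {q p : ℂ} (hp1 : ‖p‖ < 1) (hq : q ≠ 0) {n : ℕ}
    (h : thetaFac q p q n ≠ 0) {j k : ℕ} (hj : j ≤ n) (hk : k ≤ n) (hjk : j ≠ k) :
    theta p (q ^ j / q ^ k) ≠ 0 := by
  have hpos : ∀ {j k : ℕ}, j ≤ n → k < j → theta p (q ^ j / q ^ k) ≠ 0 := fun {j k} hj hkj => by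
    obtain ⟨l, rfl⟩ := Nat.exists_eq_add_of_lt hkj
    have h1 := theta_ne_zero_of_thetaFac (show l < n by omega) h
    rwa [show q ^ (k + l + 1) / q ^ k = q * q ^ l by
      rw [pow_succ, pow_add]
      field_simp]
  rcases lt_or_gt_of_ne hjk with hlt | hlt
  · rw [theta_eq_neg_mul_theta_inv hp1 (by positivity), inv_div]
    exact mul_ne_zero (neg_ne_zero.2 (by positivity)) (hpos hk hlt)
  · exact hpos hj hlt

/-- Exceptional values of `b`: outside this set, points `b q^j` and `b q^k` are never inverse to each
other modulo powers of `p`, and `(c w, c/w;q,p)_n` does not vanish at any `w = b q^k`. All `k` are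
admitted, as countability is all that matters. -/
def badNode (q p c : ℂ) (n : ℕ) : Set ℂ :=
  {0} ∪ ⋃ k : ℕ, ({b | theta p (b ^ 2 * q ^ k) = 0} ∪
    {b | thetaFacs q p [c * (b * q ^ k), c / (b * q ^ k)] n = 0})

lemma countable_badNode {q p c : ℂ} (hq : q ≠ 0) (hp1 : ‖p‖ < 1) (hc : c ≠ 0) (n : ℕ) :
    (badNode q p c n).Countable := by
  refine (Set.countable_singleton 0).union (Set.countable_iUnion fun k => ?_)
  exact (countable_sq_mul_zeros hp1 (pow_ne_zero k hq)).union
    ((countable_thetaFacs_pair_zeros hq hp1 hc n).preimage_of_injOn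
      (mul_left_injective₀ (pow_ne_zero k hq)).injOn)

lemma separatedNodes_of_notMem_badNode {q p c b : ℂ} (hp1 : ‖p‖ < 1) (hq : q ≠ 0) {n : ℕ}
    (h : thetaFac q p q n ≠ 0) (hb : b ∉ badNode q p c n) : SeparatedNodes q p b n := by
  have hb0 : b ≠ 0 := fun h0 => hb (Or.inl h0)
  refine ⟨hb0, fun j hj k hk hjk h0 => ?_, fun j hj k hk hjk => ?_⟩
  · refine hb (Or.inr (Set.mem_iUnion.2 ⟨j + k, Or.inl ?_⟩))
    rwa [show b * q ^ j * (b * q ^ k) = b ^ 2 * q ^ (j + k) by ring] at h0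
  · rw [mul_div_mul_left _ _ hb0]
    exact theta_pow_div_pow_ne_zero hp1 hq h hj hk hjk

/-- The denominator `(a q^{1-n}/c;q,p)_k` is, up to a nonzero factor, part of `(c/a;q,p)_n`. -/
lemma thetaFac_mul_zpow_div_ne_zero {q p a c : ℂ} (hp1 : ‖p‖ < 1) (hq : q ≠ 0) (ha : a ≠ 0)
    (hc : c ≠ 0) {n k : ℕ} (hk : k ≤ n) (h : thetaFac q p (c / a) n ≠ 0) :
    thetaFac q p (a * q ^ (1 - (n : ℤ)) / c) k ≠ 0 := by
  obtain ⟨l, rfl⟩ := Nat.exists_eq_add_of_le hk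
  have hqz : q ^ (1 - ((k + l : ℕ) : ℤ)) = q / q ^ (k + l) := by
    rw [zpow_sub₀ hq, zpow_one, zpow_natCast]
  rw [hqz, thetaFac_reverse (p := p) (b' := c / a * q ^ l) hp1 hq (by positivity)
    (by field_simp; ring)]
  rw [add_comm, thetaFac_add] at h
  exact mul_ne_zero (Finset.prod_ne_zero_iff.2 fun j _ => neg_ne_zero.2 (by positivity))
    (right_ne_zero_of_mul h)

section Continuity

variable {m : ℕ} {q p : ℂ} {n : Fin m → ℕ} {a c z : Fin m → ℂ}

lemma continuousAt_interpPrefactor (hq : q ≠ 0) (hp1 : ‖p‖ < 1) (ha : ∀ i, a i ≠ 0)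
    (hc : ∀ i, c i ≠ 0) (hz : ∀ i, z i ≠ 0)
    (hden_c : ∀ i, thetaFacs q p [a i * c i, c i / a i] (n i) ≠ 0)
    (hden_z : ∀ i, thetaFacs q p [a i * q * z i, a i * q / z i] (n i) ≠ 0) :
    ContinuousAt (fun x : (Fin m → ℂ) × (Fin m → ℂ) => interpPrefactor q p n c x.1 x.2)
      (a, z) := by
  unfold interpPrefactor
  refine tendsto_finsetProd _ fun i _ => ContinuousAt.div ?_ ?_ ?_
  · have h := continuousAt_thetaFacs hq hp1 (x := (a, z)) (us := [fun x => x.1 i ^ 2 * q, fun _ => q,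
      fun x => c i * x.2 i, fun x => c i / x.2 i]) (n i) (by
      simp only [List.forall_mem_cons, List.not_mem_nil, false_implies, implies_true, and_true]
      and_intros <;> first | fun_prop (disch := simp [hz]) | simp [ha, hc, hz, hq])
    simpa only [List.map_cons, List.map_nil] using h
  · have h := continuousAt_thetaFacs hq hp1 (x := (a, z)) (us := [fun x => x.1 i * c i, fun x => c i / x.1 i,
      fun x => x.1 i * q * x.2 i, fun x => x.1 i * q / x.2 i]) (n i) (by
      simp only [List.forall_mem_cons, List.not_mem_nil, false_implies, implies_true, and_true]
      and_intros <;> first | fun_prop (disch := simp [ha, hz]) | simp [ha, hc, hz, hq])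
    simpa only [List.map_cons, List.map_nil] using h
  · have h1 := hden_c i
    have h2 := hden_z i
    simp only [thetaFacs, List.map_cons, List.map_nil, List.prod_cons, List.prod_nil, mul_one,
      mul_ne_zero_iff] at h1 h2 ⊢
    exact ⟨h1.1, h1.2, h2.1, h2.2⟩

lemma continuousAt_interpCoeff (hq : q ≠ 0) (hp1 : ‖p‖ < 1) (ha : ∀ i, a i ≠ 0)
    (hc : ∀ i, c i ≠ 0) (hz : ∀ i, z i ≠ 0) (hden_a : ∀ i, theta p (a i ^ 2) ≠ 0)
    (hden_q : ∀ i, thetaFacs q p [q, a i ^ 2 * q ^ (n i + 1)] (n i) ≠ 0)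
    (hden_c : ∀ i, thetaFacs q p [a i * c i, c i / a i] (n i) ≠ 0)
    (hden_z : ∀ i, thetaFacs q p [a i * q * z i, a i * q / z i] (n i) ≠ 0)
    {k : Fin m → ℕ} (hk : ∀ i, k i ≤ n i) :
    ContinuousAt (fun x : (Fin m → ℂ) × (Fin m → ℂ) => interpCoeff q p n c k x.1 x.2)
      (a, z) := by
  have hqz : ∀ j : ℤ, q ^ j ≠ 0 := fun j => zpow_ne_zero j hq
  have htheta : ∀ i (d : ℂ), d ≠ 0 → ContinuousAt
      (fun x : (Fin m → ℂ) × (Fin m → ℂ) => theta p (x.1 i ^ 2 * d)) (a, z) := fun i d hd =>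
    continuousAt_theta_comp hp1 (u := fun x : (Fin m → ℂ) × (Fin m → ℂ) => x.1 i ^ 2 * d)
      (by fun_prop) (mul_ne_zero (pow_ne_zero 2 (ha i)) hd)
  unfold interpCoeff
  refine tendsto_finsetProd _ fun i _ =>
    (continuousAt_const.mul (ContinuousAt.div (htheta i _ (pow_ne_zero _ hq))
      (by simpa using htheta i 1 one_ne_zero) (hden_a i))).mul (ContinuousAt.div ?_ ?_ ?_)
  · have h := continuousAt_thetaFacs hq hp1 (x := (a, z)) (us := [fun _ => q ^ (-(n i : ℤ)), fun x => x.1 i ^ 2,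
      fun x => x.1 i * q / c i, fun x => x.1 i * c i * q ^ n i, fun x => x.1 i * x.2 i,
      fun x => x.1 i / x.2 i]) (k i) (by
      simp only [List.forall_mem_cons, List.not_mem_nil, false_implies, implies_true, and_true]
      and_intros <;> first | fun_prop (disch := simp [hz]) | simp [ha, hc, hz, hq])
    simpa only [List.map_cons, List.map_nil] using h
  · have h := continuousAt_thetaFacs hq hp1 (x := (a, z)) (us := [fun _ => q, fun x => x.1 i ^ 2 * q ^ (n i + 1),
      fun x => x.1 i * c i, fun x => x.1 i * q ^ (1 - (n i : ℤ)) / c i,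
      fun x => x.1 i * q * x.2 i, fun x => x.1 i * q / x.2 i]) (k i) (by
      simp only [List.forall_mem_cons, List.not_mem_nil, false_implies, implies_true, and_true]
      and_intros <;> first | fun_prop (disch := simp [hz]) | simp [ha, hc, hz, hq, hqz])
    simpa only [List.map_cons, List.map_nil] using h
  · have h1 := hden_c i
    have h2 := hden_z i
    have h3 := hden_q i
    simp only [thetaFacs, List.map_cons, List.map_nil, List.prod_cons, List.prod_nil, mul_one,
      mul_ne_zero_iff] at h1 h2 h3 ⊢
    exact ⟨thetaFac_ne_zero_of_le (hk i) h3.1, thetaFac_ne_zero_of_le (hk i) h3.2,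
      thetaFac_ne_zero_of_le (hk i) h1.1,
      thetaFac_mul_zpow_div_ne_zero hp1 hq (ha i) (hc i) (hk i) h1.2,
      thetaFac_ne_zero_of_le (hk i) h2.1, thetaFac_ne_zero_of_le (hk i) h2.2⟩

/-- The conditions on the denominators of the interpolation formula are open in `(a, z)`. -/
lemma eventually_denominators_ne_zero (hq : q ≠ 0) (hp1 : ‖p‖ < 1) (ha : ∀ i, a i ≠ 0)
    (hc : ∀ i, c i ≠ 0) (hz : ∀ i, z i ≠ 0) (hden_a : ∀ i, theta p (a i ^ 2) ≠ 0)
    (hden_q : ∀ i, thetaFacs q p [q, a i ^ 2 * q ^ (n i + 1)] (n i) ≠ 0)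
    (hden_c : ∀ i, thetaFacs q p [a i * c i, c i / a i] (n i) ≠ 0)
    (hden_z : ∀ i, thetaFacs q p [a i * q * z i, a i * q / z i] (n i) ≠ 0) :
    ∀ᶠ x : (Fin m → ℂ) × (Fin m → ℂ) in nhds (a, z), ∀ i, x.2 i ≠ 0 ∧
      theta p (x.1 i ^ 2) ≠ 0 ∧
      thetaFacs q p [q, x.1 i ^ 2 * q ^ (n i + 1)] (n i) ≠ 0 ∧
      thetaFacs q p [x.1 i * c i, c i / x.1 i] (n i) ≠ 0 ∧
      thetaFacs q p [x.1 i * q * x.2 i, x.1 i * q / x.2 i] (n i) ≠ 0 := by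
  refine Filter.eventually_all.2 fun i => ?_
  have h0 : ContinuousAt (fun x : (Fin m → ℂ) × (Fin m → ℂ) => x.2 i) (a, z) := by fun_prop
  have h1 : ContinuousAt (fun x : (Fin m → ℂ) × (Fin m → ℂ) => theta p (x.1 i ^ 2)) (a, z) :=
    continuousAt_theta_comp hp1 (u := fun x : (Fin m → ℂ) × (Fin m → ℂ) => x.1 i ^ 2)
      (by fun_prop) (pow_ne_zero 2 (ha i))
  have h2 := continuousAt_thetaFacs hq hp1 (x := (a, z)) (us :=
    [fun _ => q, fun x => x.1 i ^ 2 * q ^ (n i + 1)]) (n i) (by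
      simp only [List.forall_mem_cons, List.not_mem_nil, false_implies, implies_true, and_true]
      and_intros <;> first | fun_prop | simp [ha, hq])
  have h3 := continuousAt_thetaFacs hq hp1 (x := (a, z)) (us :=
    [fun x => x.1 i * c i, fun x => c i / x.1 i]) (n i) (by
      simp only [List.forall_mem_cons, List.not_mem_nil, false_implies, implies_true, and_true]
      and_intros <;> first | fun_prop (disch := simp [ha]) | simp [ha, hc])
  have h4 := continuousAt_thetaFacs hq hp1 (x := (a, z)) (us :=
    [fun x => x.1 i * q * x.2 i, fun x => x.1 i * q / x.2 i]) (n i) (by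
      simp only [List.forall_mem_cons, List.not_mem_nil, false_implies, implies_true, and_true]
      and_intros <;> first | fun_prop (disch := simp [hz]) | simp [ha, hq, hz])
  simp only [List.map_cons, List.map_nil] at h2 h3 h4
  filter_upwards [h0.eventually_ne (hz i), h1.eventually_ne (hden_a i),
    h2.eventually_ne (hden_q i), h3.eventually_ne (hden_c i), h4.eventually_ne (hden_z i)]
    with x e0 e1 e2 e3 e4 using ⟨e0, e1, e2, e3, e4⟩

end Continuity

open Filter Topology in
/-- The interpolation formula. Generic nodes and variables are dense, and on both sides everything
is continuous at `(a, z)`, so the formula extends from the generic case. -/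
lemma interpolation_formula {m : ℕ} {q p : ℂ} (hq : q ≠ 0) (hp0 : p ≠ 0) (hp1 : ‖p‖ < 1)
    {n : Fin m → ℕ} {a c z : Fin m → ℂ}
    (ha : ∀ i, a i ≠ 0) (hc : ∀ i, c i ≠ 0) (hz : ∀ i, z i ≠ 0)
    (hden_a : ∀ i, theta p (a i ^ 2) ≠ 0)
    (hden_q : ∀ i, thetaFacs q p [q, a i ^ 2 * q ^ (n i + 1)] (n i) ≠ 0)
    (hden_c : ∀ i, thetaFacs q p [a i * c i, c i / a i] (n i) ≠ 0)
    (hden_z : ∀ i, thetaFacs q p [a i * q * z i, a i * q / z i] (n i) ≠ 0)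
    {f : (Fin m → ℂ) → ℂ} (hf : f ∈ W q p c n) (hfz : ContinuousAt f z)
    (hfa : ∀ k : Fin m → ℕ, (∀ i, k i ≤ n i) → ContinuousAt f (fun i => a i * q ^ k i)) :
    interpPrefactor q p n c a z * f z =
      ∑ k ∈ Fintype.piFinset (fun i => Finset.range (n i + 1)),
        interpCoeff q p n c k a z * f (fun i => a i * q ^ k i) := by
  let X := (Fin m → ℂ) × (Fin m → ℂ)
  -- The dense set of generic nodes and variables.
  let D : Set X := (Set.univ.pi fun i => (badNode q p (c i) (n i))ᶜ) ×ˢ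
    (Set.univ.pi fun i => {w | thetaFacs q p [c i * w, c i / w] (n i) = 0}ᶜ)
  have hD : Dense D :=
    (dense_pi _ fun i _ => (countable_badNode hq hp1 (hc i) _).dense_compl ℂ).prod
      (dense_pi _ fun i _ => (countable_thetaFacs_pair_zeros hq hp1 (hc i) _).dense_compl ℂ)
  have : (𝓝[D] ((a, z) : X)).NeBot := mem_closure_iff_nhdsWithin_neBot.1 (hD (a, z))
  have hle : ∀ {k}, k ∈ Fintype.piFinset (fun i => Finset.range (n i + 1)) → ∀ i, k i ≤ n i :=
    fun hk i => Nat.lt_succ_iff.1 (Finset.mem_range.1 (Fintype.mem_piFinset.1 hk i))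
  have hleft : Tendsto (fun x : X => interpPrefactor q p n c x.1 x.2 * f x.2) (𝓝[D] (a, z))
      (𝓝 (interpPrefactor q p n c a z * f z)) := by
    refine Tendsto.mono_left (Tendsto.mul ?_ ?_) nhdsWithin_le_nhds
    · exact continuousAt_interpPrefactor hq hp1 ha hc hz hden_c hden_z
    · exact ContinuousAt.comp (f := fun x : (Fin m → ℂ) × (Fin m → ℂ) => x.2) hfz continuousAt_snd
  have hright : Tendsto (fun x : X => ∑ k ∈ Fintype.piFinset (fun i => Finset.range (n i + 1)),
      interpCoeff q p n c k x.1 x.2 * f (fun i => x.1 i * q ^ k i)) (𝓝[D] (a, z))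
      (𝓝 (∑ k ∈ Fintype.piFinset (fun i => Finset.range (n i + 1)),
        interpCoeff q p n c k a z * f (fun i => a i * q ^ k i))) := by
    refine tendsto_finsetSum _ fun k hk =>
      Tendsto.mono_left (Tendsto.mul ?_ ?_) nhdsWithin_le_nhds
    · exact continuousAt_interpCoeff hq hp1 ha hc hz hden_a hden_q hden_c hden_z (hle hk)
    · exact ContinuousAt.comp (f := fun (x : (Fin m → ℂ) × (Fin m → ℂ)) i => x.1 i * q ^ k i)
        (hfa k (hle hk)) (by fun_prop)
  refine tendsto_nhds_unique_of_eventuallyEq hleft hright ?_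
  filter_upwards [self_mem_nhdsWithin, nhdsWithin_le_nhds (eventually_denominators_ne_zero hq hp1
    ha hc hz hden_a hden_q hden_c hden_z)] with x hxD hx
  have hnode : ∀ i, x.1 i ∉ badNode q p (c i) (n i) := fun i => hxD.1 i (Set.mem_univ i)
  refine interpolation_of_generic hq hp0 hp1 hc (fun i => (hx i).1) (fun i => ?_)
    (fun i => (hx i).2.1) (fun i => (hx i).2.2.1) (fun i => (hx i).2.2.2.1)
    (fun i => (hx i).2.2.2.2) (fun i => hxD.2 i (Set.mem_univ i)) (fun i k _ h0 => ?_) hf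
  · refine separatedNodes_of_notMem_badNode hp1 hq (fun h0 => hden_q i ?_) (hnode i)
    simp [thetaFacs, h0]
  · exact hnode i (Or.inr (Set.mem_iUnion.2 ⟨k, Or.inr h0⟩))

end EllipticInterpolation

theorem theorem2p10 {m : ℕ} (q p : ℂ) (hq : q ≠ 0) (hp0 : p ≠ 0) (hp1 : ‖p‖ < 1)
    (n : Fin m → ℕ) (a c z : Fin m → ℂ)
    (ha : ∀ i, a i ≠ 0) (hc : ∀ i, c i ≠ 0) (hz : ∀ i, z i ≠ 0)
    -- no denominator of the formula vanishes
    (hden_a : ∀ i, EllipticInterpolation.theta p (a i ^ 2) ≠ 0)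
    (hden_q : ∀ i, EllipticInterpolation.thetaFacs q p
      [q, a i ^ 2 * q ^ (n i + 1)] (n i) ≠ 0)
    (hden_c : ∀ i, EllipticInterpolation.thetaFacs q p
      [a i * c i, c i / a i] (n i) ≠ 0)
    (hden_z : ∀ i, EllipticInterpolation.thetaFacs q p
      [a i * q * z i, a i * q / z i] (n i) ≠ 0)
    (f : (Fin m → ℂ) → ℂ) (hf : f ∈ EllipticInterpolation.W q p c n)
    -- the meromorphic function `f` is regular at the points where the formula evaluates it;
    -- this is automatic where the denominators `(c_i z_i, c_i/z_i;q,p)_{n_i}` do not vanish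
    (hfz : ContinuousAt f z)
    (hfa : ∀ k : Fin m → ℕ, (∀ i, k i ≤ n i) → ContinuousAt f (fun i => a i * q ^ k i)) :
    (∏ i, EllipticInterpolation.thetaFacs q p
        [a i ^ 2 * q, q, c i * z i, c i / z i] (n i) /
      EllipticInterpolation.thetaFacs q p
        [a i * c i, c i / a i, a i * q * z i, a i * q / z i] (n i)) * f z =
    ∑ k ∈ Fintype.piFinset (fun i => Finset.range (n i + 1)),
      (∏ i, q ^ k i *
        (EllipticInterpolation.theta p (a i ^ 2 * q ^ (2 * k i)) /
          EllipticInterpolation.theta p (a i ^ 2)) *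
        (EllipticInterpolation.thetaFacs q p
            [q ^ (-(n i : ℤ)), a i ^ 2, a i * q / c i, a i * c i * q ^ n i,
              a i * z i, a i / z i] (k i) /
          EllipticInterpolation.thetaFacs q p
            [q, a i ^ 2 * q ^ (n i + 1), a i * c i, a i * q ^ (1 - (n i : ℤ)) / c i,
              a i * q * z i, a i * q / z i] (k i))) *
      f (fun i => a i * q ^ k i) := by
  exact EllipticInterpolation.interpolation_formula hq hp0 hp1 ha hc hz hden_a hden_q hden_c hden_z
    hf hfz hfa
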